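/- The machine model is the word RAM with words of $O(\log N)$ bits on inputs of size $N$ and unit-cost operations; algorithms are deterministic. \emph{Partial 2-Dominating Set}: given a graph $G=(V,E)$ by a list of its edges, with $n=|V|\ge 1$ vertices and $m=|E|\ge n$ edges, compute $$\max_{x_1,x_2\in V}\bigl|N[x_1]\cup N[x_2]\bigr|,$$ the largest number of vertices that can be dominated by two vertices, where $N[v]=\{v\}\cup\{u : \{u,v\}\in E\}$. \emph{Orthogonal Vectors} (OV): given two families $A_1,A_2$ of $n\ge 1$ vectors in $\{0,1\}^d$, decide whether there are $a_1\in A_1$, $a_2\in A_2$ with $\sum_{y=1}^d a_1[y]\,a_2[y]=0$. \emph{OV Hypothesis}: for no $\varepsilon>0$ and no function $D:\mathbb{N}\to\mathbb{N}$ with $D(n)=\omega(\log n)$ is there an algorithm that solves all OV instances with $d\le D(n)$ in time $O(n^{2-\varepsilon})$. \textbf{Theorem.} Let $\varepsilon>0$. If there exists an algorithm solving Partial 2-Dominating Set in time $O(m^{4/3-\varepsilon})$, then the OV Hypothesis is false. -/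

import Mathlib

/-! ## The word RAM

The machine has registers and a random access memory, both indexed by `ℕ`, holding natural
numbers.  Every operation takes one step.  A run is legal only if every number that it produces
fits into a machine word of `O(log N)` bits, `N` being the size of the input; see `Exec` and
`Cmd.OutputsWithin`.  Programs are written in structured form (sequencing, branching, loops);
compared with jumps this changes the number of steps by at most a constant factor that depends
only on the program. -/

namespace WordRAM

/-- The operations of the arithmetic unit. -/
inductive BinOp where
  | add | sub | mul | div | mod | and | or | xor | shl | shr | lt | eq

/-- Subtraction is truncated at `0`, `a / 0 = 0`, `a % 0 = a`, and comparisons return `0` or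
`1`. -/
def BinOp.eval : BinOp → ℕ → ℕ → ℕ
  | .add, a, b => a + b
  | .sub, a, b => a - b
  | .mul, a, b => a * b
  | .div, a, b => a / b
  | .mod, a, b => a % b
  | .and, a, b => a &&& b
  | .or, a, b => a ||| b
  | .xor, a, b => a ^^^ b
  | .shl, a, b => a <<< b
  | .shr, a, b => a >>> b
  | .lt, a, b => if a < b then 1 else 0
  | .eq, a, b => if a = b then 1 else 0

/-- Programs.  The natural number arguments `r`, `a`, `b` are names of registers. -/
inductive Cmd where
  /-- do nothing -/
  | skip
  /-- `r := k` -/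
  | const (r k : ℕ)
  /-- `r := f a b` -/
  | op (f : BinOp) (r a b : ℕ)
  /-- `r := mem[a]` (indirect addressing) -/
  | load (r a : ℕ)
  /-- `mem[a] := b` (indirect addressing) -/
  | store (a b : ℕ)
  /-- `P ; Q` -/
  | seq (P Q : Cmd)
  /-- if `r ≠ 0` then `P` else `Q` -/
  | cond (r : ℕ) (P Q : Cmd)
  /-- while `r ≠ 0` do `P` -/
  | loop (r : ℕ) (P : Cmd)

/-- A configuration: the contents of the registers and of the memory. -/
structure State where
  reg : ℕ → ℕ
  mem : ℕ → ℕ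

/-- Write `v` into register `r`. -/
def State.setReg (s : State) (r v : ℕ) : State :=
  { s with reg := Function.update s.reg r v }

/-- Write `v` into the memory cell with address `i`. -/
def State.setMem (s : State) (i v : ℕ) : State :=
  { s with mem := Function.update s.mem i v }

/-- `Exec W P s s' t`: started in `s`, the program `P` halts in `s'` after exactly `t` steps, and
every number written into a register by a constant or by the arithmetic unit is less than `W`
(if some number does not fit, there is no legal run). -/
inductive Exec (W : ℕ) : Cmd → State → State → ℕ → Prop
  | skip (s : State) : Exec W .skip s s 1
  | const (s : State) (r k : ℕ) (h : k < W) : Exec W (.const r k) s (s.setReg r k) 1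
  | op (s : State) (f : BinOp) (r a b : ℕ) (h : f.eval (s.reg a) (s.reg b) < W) :
      Exec W (.op f r a b) s (s.setReg r (f.eval (s.reg a) (s.reg b))) 1
  | load (s : State) (r a : ℕ) : Exec W (.load r a) s (s.setReg r (s.mem (s.reg a))) 1
  | store (s : State) (a b : ℕ) : Exec W (.store a b) s (s.setMem (s.reg a) (s.reg b)) 1
  | seq (P Q : Cmd) (s₁ s₂ s₃ : State) (t₁ t₂ : ℕ) (h₁ : Exec W P s₁ s₂ t₁)
      (h₂ : Exec W Q s₂ s₃ t₂) : Exec W (.seq P Q) s₁ s₃ (t₁ + t₂)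
  | condTrue (r : ℕ) (P Q : Cmd) (s s' : State) (t : ℕ) (hr : s.reg r ≠ 0)
      (h : Exec W P s s' t) : Exec W (.cond r P Q) s s' (t + 1)
  | condFalse (r : ℕ) (P Q : Cmd) (s s' : State) (t : ℕ) (hr : s.reg r = 0)
      (h : Exec W Q s s' t) : Exec W (.cond r P Q) s s' (t + 1)
  | loopDone (r : ℕ) (P : Cmd) (s : State) (hr : s.reg r = 0) : Exec W (.loop r P) s s 1
  | loopStep (r : ℕ) (P : Cmd) (s₁ s₂ s₃ : State) (t₁ t₂ : ℕ) (hr : s₁.reg r ≠ 0)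
      (h₁ : Exec W P s₁ s₂ t₁) (h₂ : Exec W (.loop r P) s₂ s₃ t₂) :
      Exec W (.loop r P) s₁ s₃ (t₁ + t₂ + 1)

/-- The initial configuration: the input is in the memory cells `0, 1, 2, …`, and everything else
is `0`. -/
def initState (x : List ℕ) : State where
  reg := fun _ => 0
  mem := fun i => x.getD i 0

/-- The size of an input, as far as the word length is concerned: the number of its words plus the
largest of them (plus `2`, so that it is at least `2`). -/
def inputSize (x : List ℕ) : ℕ := x.length + x.foldr max 0 + 2

/-- With words for the numbers below `N ^ c`, i.e. of `c log₂ N` bits, where `N` is the size of the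
input `x`, the program `P` halts on `x` after at most `T` steps, with `y` in register `0`. -/
def Cmd.OutputsWithin (P : Cmd) (c : ℕ) (x : List ℕ) (y : ℕ) (T : ℝ) : Prop :=
  ∃ (s : State) (t : ℕ),
    Exec (inputSize x ^ c) P (initState x) s t ∧ s.reg 0 = y ∧ (t : ℝ) ≤ T

end WordRAM

/-! ## Partial 2-Dominating Set -/

namespace PartialDom

/-- `E` lists every edge of `G` exactly once, in an arbitrary order and orientation. -/
def IsEdgeList {n : ℕ} (G : SimpleGraph (Fin n)) (E : List (Fin n × Fin n)) : Prop :=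
  (E.map fun e => s(e.1, e.2)).Nodup ∧
    ∀ e : Sym2 (Fin n), e ∈ E.map (fun e => s(e.1, e.2)) ↔ e ∈ G.edgeSet

/-- A graph on `{0, …, n - 1}` as a list of words: `n`, `m`, and then the two ends of each of the
`m` edges. -/
def encode {n : ℕ} (E : List (Fin n × Fin n)) : List ℕ :=
  n :: E.length :: E.flatMap fun e => [(e.1 : ℕ), (e.2 : ℕ)]

/-- The closed neighborhood `N[v]`, the set of the vertices that `v` dominates. -/
def closedNbhd {V : Type*} (G : SimpleGraph V) (v : V) : Set V :=
  insert v (G.neighborSet v)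

/-- `t` is the largest number of vertices that can be dominated by two vertices. -/
def IsOptimum {V : Type*} (G : SimpleGraph V) (t : ℕ) : Prop :=
  IsGreatest {k : ℕ | ∃ x₁ x₂ : V, k = (closedNbhd G x₁ ∪ closedNbhd G x₂).ncard} t

/-- The program `P` solves Partial 2-Dominating Set in time `T(m)`: on every nonempty graph with
`n` vertices and `m ≥ n` edges, given by a list of its edges, it computes the optimum in at most
`T(m)` steps, on words of `O(log m)` bits. -/
def Solves (P : WordRAM.Cmd) (T : ℕ → ℝ) : Prop :=
  ∃ c : ℕ, ∀ (n : ℕ) (G : SimpleGraph (Fin n)) (E : List (Fin n × Fin n)) (t : ℕ),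
    1 ≤ n → n ≤ G.edgeSet.ncard → IsEdgeList G E → IsOptimum G t →
      P.OutputsWithin c (encode E) t (T G.edgeSet.ncard)

end PartialDom

/-! ## Orthogonal Vectors -/

namespace OV

/-- `n` binary vectors of dimension `d`, row by row, one word for each entry. -/
def encodeVectors {n d : ℕ} (A : Fin n → Fin d → Bool) : List ℕ :=
  (List.ofFn fun i => List.ofFn fun y => (A i y).toNat).flatten

/-- An instance as a list of words: `n`, `d`, and then the two families of vectors. -/
def encode {n d : ℕ} (A B : Fin n → Fin d → Bool) : List ℕ :=
  n :: d :: (encodeVectors A ++ encodeVectors B)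

/-- Some vector of `A` is orthogonal to some vector of `B`. -/
def HasOrthogonalPair {n d : ℕ} (A B : Fin n → Fin d → Bool) : Prop :=
  ∃ i j, ∑ y, (A i y).toNat * (B j y).toNat = 0

open Classical in
/-- The program `P` solves Orthogonal Vectors in dimensions up to `D(n)` in time `T(n)`: on all
families of `n ≥ 1` vectors of dimension `d ≤ D(n)` it decides in at most `T(n)` steps, on words of
`O(log (n + d))` bits, whether there is an orthogonal pair (answer `1` for yes, `0` for no). -/
def Solves (P : WordRAM.Cmd) (D : ℕ → ℕ) (T : ℕ → ℝ) : Prop :=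
  ∃ c : ℕ, ∀ (n d : ℕ) (A B : Fin n → Fin d → Bool), 1 ≤ n → d ≤ D n →
    P.OutputsWithin c (encode A B) (if HasOrthogonalPair A B then 1 else 0) (T n)

/-- The OV Hypothesis: for no `ε > 0` is there an algorithm that solves Orthogonal Vectors in time
`O(n ^ (2 - ε))` in a regime of dimensions `D(n) = ω(log n)`. -/
def Hypothesis : Prop :=
  ¬ ∃ (ε : ℝ) (D : ℕ → ℕ), 0 < ε ∧
    (fun n : ℕ => Real.log n) =o[Filter.atTop] (fun n : ℕ => (D n : ℝ)) ∧
    ∃ (P : WordRAM.Cmd) (C : ℝ), Solves P D fun n => C * (n : ℝ) ^ (2 - ε)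

end OV

/-!
Extend every vector by the unit vector of its family, so that two vectors of the same family are
never orthogonal.  The extended vectors become *points*, divided into `2 * s` groups of size
`s ≈ √n`.  A point has one link for each group `h` and each coordinate `y`.  If the point belongs to
the group `g` and its vector has a `1` at `y`, the link leads to a vertex of the unordered pair
`{g, h}` and `y`, otherwise to a different vertex of the ordered pair `(g, h)` and `y`.  Points of
different groups `g` and `h` thus have a common neighbor, namely at `{g, h}`, if and only if their
vectors have a common `1`, and points of one group belong to the same family.  All points have the
same degree `2 * s * (d + 2)`, while the other vertices have at most `2 * s` neighbors.  Hence two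
vertices dominate `2 * (2 * s * (d + 2) + 1)` vertices if and only if they are points with
orthogonal vectors.

A point has links for `2 * s` groups, instead of `n` partners, and so there are only
`m = 4 * s ^ 3 * (d + 2) ≈ n ^ (3 / 2) * d` edges.  If `d ≈ log² n`, then `m ^ (4 / 3 - ε)` is at
most `n ^ (2 - η)` up to a constant factor, for some `η > 0`.

On the machine, the reduction writes the edges over the instance, so it first copies the vectors
behind the last edge, and it keeps its variables in registers that the given program never uses.
-/

namespace WordRAM

/-! ### Running a program inside a larger one -/

theorem Exec.mono {W W' : ℕ} (hW : W ≤ W') {P : Cmd} {s s' : State} {t : ℕ}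
    (h : Exec W P s s' t) : Exec W' P s s' t := by
  induction h with
  | skip s => exact .skip s
  | const s r k hk => exact .const s r k (hk.trans_le hW)
  | op s f r a b hv => exact .op s f r a b (hv.trans_le hW)
  | load s r a => exact .load s r a
  | store s a b => exact .store s a b
  | seq _ _ _ _ _ _ _ _ _ ih₁ ih₂ => exact .seq _ _ _ _ _ _ _ ih₁ ih₂
  | condTrue _ _ _ _ _ _ hr _ ih => exact .condTrue _ _ _ _ _ _ hr ih
  | condFalse _ _ _ _ _ _ hr _ ih => exact .condFalse _ _ _ _ _ _ hr ih
  | loopDone r P s hr => exact .loopDone r P s hr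
  | loopStep _ _ _ _ _ _ _ hr _ _ ih₁ ih₂ => exact .loopStep _ _ _ _ _ _ _ hr ih₁ ih₂

/-- The least strict upper bound of the registers that occur in a program. -/
def Cmd.regBound : Cmd → ℕ
  | .skip => 0
  | .const r _ => r + 1
  | .op _ r a b => max (r + 1) (max (a + 1) (b + 1))
  | .load r a => max (r + 1) (a + 1)
  | .store a b => max (a + 1) (b + 1)
  | .seq P Q => max P.regBound Q.regBound
  | .cond r P Q => max (r + 1) (max P.regBound Q.regBound)
  | .loop r P => max (r + 1) P.regBound

theorem State.reg_setReg (s : State) (r v r' : ℕ) :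
    (s.setReg r v).reg r' = if r' = r then v else s.reg r' :=
  Function.update_apply s.reg r v r'

theorem State.reg_setReg_self (s : State) (r v : ℕ) : (s.setReg r v).reg r = v :=
  (s.reg_setReg r v r).trans (if_pos rfl)

theorem State.reg_setReg_of_ne (s : State) {r r' : ℕ} (v : ℕ) (h : r' ≠ r) :
    (s.setReg r v).reg r' = s.reg r' :=
  (s.reg_setReg r v r').trans (if_neg h)

theorem Exec.reg_eq_of_regBound_le {W : ℕ} {P : Cmd} {s s' : State} {t : ℕ}
    (h : Exec W P s s' t) {r : ℕ} (hr : P.regBound ≤ r) : s'.reg r = s.reg r := by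
  induction h with
  | skip | store | loopDone => rfl
  | const | op | load =>
    simp only [Cmd.regBound] at hr
    exact State.reg_setReg_of_ne _ _ (by omega)
  | seq _ _ _ _ _ _ _ _ _ ih₁ ih₂ =>
    simp only [Cmd.regBound] at hr
    exact (ih₂ (by omega)).trans (ih₁ (by omega))
  | condTrue _ _ _ _ _ _ _ _ ih | condFalse _ _ _ _ _ _ _ _ ih =>
    simp only [Cmd.regBound] at hr
    exact ih (by omega)
  | loopStep _ _ _ _ _ _ _ _ _ _ ih₁ ih₂ =>
    have hr' := hr
    simp only [Cmd.regBound] at hr'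
    exact (ih₂ hr).trans (ih₁ (by omega))

/-- The two states have the same memory and the same registers below `B`: a program that uses only
these registers cannot tell them apart. -/
structure State.AgreeBelow (B : ℕ) (s u : State) : Prop where
  reg : ∀ r < B, u.reg r = s.reg r
  mem : u.mem = s.mem

theorem State.AgreeBelow.setReg {B : ℕ} {s u : State} (h : s.AgreeBelow B u) (r v : ℕ) :
    (s.setReg r v).AgreeBelow B (u.setReg r v) where
  reg r' hr' := by simp only [State.reg_setReg, h.reg r' hr']
  mem := h.mem

theorem Exec.exists_of_agreeBelow {W B : ℕ} {P : Cmd} {s s' u : State} {t : ℕ}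
    (h : Exec W P s s' t) (hB : P.regBound ≤ B) (hu : s.AgreeBelow B u) :
    ∃ u', Exec W P u u' t ∧ s'.AgreeBelow B u' := by
  induction h generalizing u with simp only [Cmd.regBound] at hB
  | skip => exact ⟨u, .skip u, hu⟩
  | const s r k hk => exact ⟨_, .const u r k hk, hu.setReg r k⟩
  | op s f r a b hv =>
    rw [← hu.reg a (by omega), ← hu.reg b (by omega)] at hv ⊢
    exact ⟨_, .op u f r a b hv, hu.setReg r _⟩
  | load s r a =>
    rw [← hu.reg a (by omega), ← hu.mem]
    exact ⟨_, .load u r a, hu.setReg r _⟩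
  | store s a b =>
    refine ⟨_, .store u a b, hu.reg, ?_⟩
    simp only [State.setMem, hu.reg a (by omega), hu.reg b (by omega), hu.mem]
  | seq _ _ _ _ _ _ _ _ _ ih₁ ih₂ =>
    obtain ⟨u₂, h₂, hu₂⟩ := ih₁ (by omega) hu
    obtain ⟨u₃, h₃, hu₃⟩ := ih₂ (by omega) hu₂
    exact ⟨u₃, .seq _ _ _ _ _ _ _ h₂ h₃, hu₃⟩
  | condTrue _ _ _ _ _ _ hr _ ih =>
    obtain ⟨u', h', hu'⟩ := ih (by omega) hu
    exact ⟨u', .condTrue _ _ _ _ _ _ (by rwa [hu.reg _ (by omega)]) h', hu'⟩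
  | condFalse _ _ _ _ _ _ hr _ ih =>
    obtain ⟨u', h', hu'⟩ := ih (by omega) hu
    exact ⟨u', .condFalse _ _ _ _ _ _ (by rwa [hu.reg _ (by omega)]) h', hu'⟩
  | loopDone _ _ _ hr =>
    exact ⟨u, .loopDone _ _ _ (by rwa [hu.reg _ (by omega)]), hu⟩
  | loopStep _ _ _ _ _ _ _ hr _ _ ih₁ ih₂ =>
    obtain ⟨u₂, h₂, hu₂⟩ := ih₁ (by omega) hu
    obtain ⟨u₃, h₃, hu₃⟩ := ih₂ hB hu₂
    exact ⟨u₃, .loopStep _ _ _ _ _ _ _ (by rwa [hu.reg _ (by omega)]) h₂ h₃, hu₃⟩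

/-! ### Expressions -/

/-- The contents of the variables of a program, which are named by `ν`, and of the memory. -/
structure Store (ν : Type*) where
  var : ν → ℕ
  mem : ℕ → ℕ

/-- The arithmetic operations, all of which are bounded by polynomials, and the comparisons. -/
def BinOp.IsArith : BinOp → Prop
  | .and | .or | .xor | .shl | .shr => False
  | _ => True

/-- Expressions over the variables `ν`, without operations on bits: left shifts would break
`Expr.eval_lt_pow_weight`. -/
inductive Expr (ν : Type*) where
  | var (x : ν)
  | lit (k : ℕ)
  | op (f : BinOp) (hf : f.IsArith) (a b : Expr ν)
  | load (a : Expr ν)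

variable {ν : Type*}

namespace Expr

instance (k : ℕ) : OfNat (Expr ν) k := ⟨.lit k⟩
instance : Add (Expr ν) := ⟨.op .add trivial⟩
instance : Sub (Expr ν) := ⟨.op .sub trivial⟩
instance : Mul (Expr ν) := ⟨.op .mul trivial⟩
instance : Div (Expr ν) := ⟨.op .div trivial⟩
instance : Mod (Expr ν) := ⟨.op .mod trivial⟩

/-- The expression with value `1` if `a < b`, and `0` otherwise. -/
def lt (a b : Expr ν) : Expr ν := .op .lt trivial a b

/-- The expression with value `1` if `a = b`, and `0` otherwise. -/
def eq (a b : Expr ν) : Expr ν := .op .eq trivial a b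

/-- The value of an expression. -/
def eval (σ : Store ν) : Expr ν → ℕ
  | .var x => σ.var x
  | .lit k => k
  | .op f _ a b => f.eval (a.eval σ) (b.eval σ)
  | .load a => σ.mem (a.eval σ)

section EvalLemmas

variable (σ : Store ν) (a b : Expr ν)

@[simp] theorem eval_var (x : ν) : (Expr.var x).eval σ = σ.var x := rfl
@[simp] theorem eval_ofNat (k : ℕ) : (ofNat(k) : Expr ν).eval σ = ofNat(k) := rfl
@[simp] theorem eval_add : (a + b).eval σ = a.eval σ + b.eval σ := rfl
@[simp] theorem eval_sub : (a - b).eval σ = a.eval σ - b.eval σ := rfl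
@[simp] theorem eval_mul : (a * b).eval σ = a.eval σ * b.eval σ := rfl
@[simp] theorem eval_div : (a / b).eval σ = a.eval σ / b.eval σ := rfl
@[simp] theorem eval_mod : (a % b).eval σ = a.eval σ % b.eval σ := rfl
@[simp] theorem eval_lt : (a.lt b).eval σ = if a.eval σ < b.eval σ then 1 else 0 := rfl
@[simp] theorem eval_eq : (a.eq b).eval σ = if a.eval σ = b.eval σ then 1 else 0 := rfl
@[simp] theorem eval_load : (Expr.load a).eval σ = σ.mem (a.eval σ) := rfl

end EvalLemmas

/-- The number of steps in which `Expr.compile` evaluates an expression. -/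
def size : Expr ν → ℕ
  | .var _ | .lit _ => 1
  | .op _ _ a b => a.size + (b.size + 1)
  | .load a => a.size + 1

/-- A bound for the degree of the growth of an expression, see `Expr.eval_lt_pow_weight`. -/
def weight : Expr ν → ℕ
  | .var _ => 1
  | .lit k => k
  | .op _ _ a b => a.weight + b.weight + 1
  | .load a => a.weight + 1

/-- Evaluate an expression into register `t`, with intermediate results in the registers after `t`,
if the variables are in the registers `loc`. -/
def compile (loc : ν → ℕ) (t : ℕ) : Expr ν → Cmd
  | .var x => .op .and t (loc x) (loc x)
  | .lit k => .const t k
  | .op f _ a b => .seq (a.compile loc t) (.seq (b.compile loc (t + 1)) (.op f t t (t + 1)))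
  | .load a => .seq (a.compile loc t) (.load t t)

end Expr

/-- All variables and memory cells are less than `M`. -/
structure Store.Bounded (M : ℕ) (σ : Store ν) : Prop where
  two_le : 2 ≤ M
  var_lt : ∀ x, σ.var x < M
  mem_lt : ∀ a, σ.mem a < M

theorem BinOp.IsArith.eval_lt {f : BinOp} (hf : f.IsArith) (a b : ℕ) :
    f.eval a b < (a + 1) * (b + 1) * 2 := by
  have hprod : a + b + a * b + 1 = (a + 1) * (b + 1) := by ring
  have hdiv : a / b ≤ a := Nat.div_le_self a b
  have hmod : a % b ≤ a := Nat.mod_le a b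
  rw [← hprod]
  cases f <;> first | exact hf.elim | (simp only [BinOp.eval]; (try split_ifs) <;> omega)

section Compile

variable {M W : ℕ} {σ : Store ν}

theorem Expr.eval_lt_pow_weight (hσ : σ.Bounded M) (e : Expr ν) :
    e.eval σ < M ^ e.weight := by
  induction e with
  | var x => exact (hσ.var_lt x).trans_eq (pow_one M).symm
  | lit k => exact Nat.lt_two_pow_self.trans_le (Nat.pow_le_pow_left hσ.two_le k)
  | op f hf a b iha ihb =>
    calc f.eval (a.eval σ) (b.eval σ)
      _ < (a.eval σ + 1) * (b.eval σ + 1) * 2 := hf.eval_lt _ _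
      _ ≤ M ^ a.weight * M ^ b.weight * M := by gcongr <;> first | assumption | exact hσ.two_le
      _ = M ^ (a.weight + b.weight + 1) := by rw [pow_succ, pow_add]
  | load a _ => exact (hσ.mem_lt _).trans_le (Nat.le_self_pow (Nat.succ_ne_zero _) M)

theorem Expr.exec_compile (hσ : σ.Bounded M) {loc : ν → ℕ} (e : Expr ν)
    (hW : M ^ e.weight ≤ W) {t : ℕ} (hloc : ∀ x, loc x < t) {u : State}
    (hvar : ∀ x, u.reg (loc x) = σ.var x) (hmem : u.mem = σ.mem) :
    ∃ u', Exec W (e.compile loc t) u u' e.size ∧ u'.reg t = e.eval σ ∧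
      u.AgreeBelow t u' := by
  have hlt := (e.eval_lt_pow_weight hσ).trans_le hW
  have hpow {i j : ℕ} (hij : i ≤ j) : M ^ i ≤ M ^ j :=
    Nat.pow_le_pow_right (two_pos.trans_le hσ.two_le) hij
  induction e generalizing t u with
  | var x =>
    have hv : BinOp.and.eval (u.reg (loc x)) (u.reg (loc x)) = σ.var x := by
      simp only [BinOp.eval, hvar, Nat.and_self]
    refine ⟨_, .op u .and t (loc x) (loc x) (by rwa [hv]), ?_, fun r hr => ?_, rfl⟩
    · rw [State.reg_setReg_self, hv]; rfl
    · exact State.reg_setReg_of_ne _ _ hr.ne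
  | lit k =>
    exact ⟨_, .const u t k hlt, State.reg_setReg_self _ _ _,
      fun r hr => State.reg_setReg_of_ne _ _ hr.ne, rfl⟩
  | op f hf a b iha ihb =>
    have hWa : M ^ a.weight ≤ W := (hpow (by simp only [weight]; omega)).trans hW
    have hWb : M ^ b.weight ≤ W := (hpow (by simp only [weight]; omega)).trans hW
    obtain ⟨u₁, h₁, ha, hu₁⟩ :=
      iha hWa hloc hvar hmem ((a.eval_lt_pow_weight hσ).trans_le hWa)
    obtain ⟨u₂, h₂, hb, hu₂⟩ := ihb hWb (t := t + 1) (fun x => (hloc x).trans (Nat.lt_succ_self t))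
      (fun x => (hu₁.reg _ (hloc x)).trans (hvar x)) (hu₁.mem.trans hmem)
      ((b.eval_lt_pow_weight hσ).trans_le hWb)
    have hv : f.eval (u₂.reg t) (u₂.reg (t + 1)) = f.eval (a.eval σ) (b.eval σ) := by
      rw [hb, hu₂.reg t (Nat.lt_succ_self t), ha]
    refine ⟨_, .seq _ _ _ _ _ _ _ h₁ (.seq _ _ _ _ _ _ _ h₂ (.op u₂ f t t (t + 1) ?_)), ?_,
      fun r hr => ?_, hu₂.mem.trans hu₁.mem⟩
    · rwa [hv]
    · rw [State.reg_setReg_self, hv]; rfl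
    · rw [State.reg_setReg_of_ne _ _ hr.ne, hu₂.reg r (by omega), hu₁.reg r hr]
  | load a iha =>
    have hWa : M ^ a.weight ≤ W := (hpow (Nat.le_succ _)).trans hW
    obtain ⟨u₁, h₁, ha, hu₁⟩ :=
      iha hWa hloc hvar hmem ((a.eval_lt_pow_weight hσ).trans_le hWa)
    refine ⟨_, .seq _ _ _ _ _ _ _ h₁ (.load u₁ t t), ?_, fun r hr => ?_, hu₁.mem⟩
    · rw [State.reg_setReg_self, ha, hu₁.mem, hmem]; rfl
    · rw [State.reg_setReg_of_ne _ _ hr.ne, hu₁.reg r hr]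

end Compile

/-! ### Programs over named variables -/

/-- The memory `mem` with `v 0, …, v (N - 1)` in the cells `a, …, a + N - 1`. -/
def writeBlock (mem : ℕ → ℕ) (a N : ℕ) (v : ℕ → ℕ) (c : ℕ) : ℕ :=
  if a ≤ c ∧ c < a + N then v (c - a) else mem c

theorem writeBlock_update_zero_one (mem : ℕ → ℕ) (N : ℕ) (v : ℕ → ℕ) :
    writeBlock (Function.update (Function.update mem 0 (v 0)) 1 (v 1)) 2 N (fun k => v (k + 2)) =
      writeBlock mem 0 (N + 2) v := by
  funext c
  match c with
  | 0 | 1 => simp [writeBlock]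
  | c + 2 => simp [writeBlock, add_comm 2 N]

namespace Store

/-- Write `v` into the memory cell with address `a`. -/
def write (σ : Store ν) (a v : ℕ) : Store ν :=
  { σ with mem := Function.update σ.mem a v }

/-- Write `v 0, …, v (N - 1)` into the `N` memory cells from address `a` on. -/
def overwrite (σ : Store ν) (a N : ℕ) (v : ℕ → ℕ) : Store ν :=
  { σ with mem := writeBlock σ.mem a N v }

theorem overwrite_zero (σ : Store ν) (a : ℕ) (v : ℕ → ℕ) : σ.overwrite a 0 v = σ :=
  congrArg (Store.mk σ.var) (funext fun _ => if_neg (by omega))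

theorem Bounded.write {M : ℕ} {σ : Store ν} (hσ : σ.Bounded M) (a : ℕ) {v : ℕ} (hv : v < M) :
    (σ.write a v).Bounded M where
  two_le := hσ.two_le
  var_lt := hσ.var_lt
  mem_lt c := by
    simp only [Store.write, Function.update_apply]
    split_ifs
    exacts [hv, hσ.mem_lt c]

variable [DecidableEq ν]

/-- Assign the value `v` to the variable `x`. -/
def set (σ : Store ν) (x : ν) (v : ℕ) : Store ν :=
  { σ with var := Function.update σ.var x v }

@[simp] theorem var_set (σ : Store ν) (x y : ν) (v : ℕ) :
    (σ.set x v).var y = if y = x then v else σ.var y :=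
  Function.update_apply σ.var x v y

theorem set_set (σ : Store ν) (x : ν) (v w : ℕ) : (σ.set x v).set x w = σ.set x w := by
  simp only [set, Function.update_idem]

theorem write_overwrite (σ : Store ν) (x : ν) (w a k : ℕ) (v : ℕ → ℕ) :
    ((σ.overwrite a k v).set x w).write (a + k) (v k) = (σ.overwrite a (k + 1) v).set x w := by
  simp only [write, set, overwrite, Store.mk.injEq, true_and]
  funext c
  simp only [Function.update_apply, writeBlock]
  split_ifs <;> first | omega | rfl | simp_all

theorem Bounded.set {M : ℕ} {σ : Store ν} (hσ : σ.Bounded M) (x : ν) {v : ℕ} (hv : v < M) :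
    (σ.set x v).Bounded M where
  two_le := hσ.two_le
  var_lt y := by rw [var_set]; split_ifs; exacts [hv, hσ.var_lt y]
  mem_lt := hσ.mem_lt

end Store

/-- An assignment of registers to the variables `ν`: they follow the first `low` registers, and are
followed by the registers in which expressions are evaluated. -/
structure Layout (ν : Type*) where
  low : ℕ
  size : ℕ
  index : ν ↪ Fin size

namespace Layout

variable (L : Layout ν)

/-- The register of a variable. -/
def reg (x : ν) : ℕ := L.low + L.index x

/-- The first of the registers in which expressions are evaluated. -/
def scratch : ℕ := L.low + L.size

theorem reg_lt_scratch (x : ν) : L.reg x < L.scratch :=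
  Nat.add_lt_add_left (L.index x).isLt L.low

theorem reg_injective : Function.Injective L.reg := fun _ _ h =>
  L.index.injective (Fin.ext (Nat.add_left_cancel h))

/-- The machine is in the state `σ`, with contents less than `M`.  The low registers are `0`, as a
subroutine that uses only them expects. -/
structure Represents (M : ℕ) (σ : Store ν) (u : State) : Prop where
  reg_low : ∀ r < L.low, u.reg r = 0
  reg_var : ∀ x, u.reg (L.reg x) = σ.var x
  mem_eq : u.mem = σ.mem
  bounded : σ.Bounded M

/-- With words for the numbers below `M ^ K`, the program `P` turns the state `σ` into the state
`τ`, all of whose contents are less than `M`, in at most `T` steps. -/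
def Runs (M K : ℕ) (P : Cmd) (σ τ : Store ν) (T : ℕ) : Prop :=
  ∀ u, L.Represents M σ u → ∃ v t, Exec (M ^ K) P u v t ∧ t ≤ T ∧ L.Represents M τ v

/-- The program for the assignment `x := e`. -/
def assign (x : ν) (e : Expr ν) : Cmd :=
  .seq (e.compile L.reg L.scratch) (.op .and (L.reg x) L.scratch L.scratch)

/-- The program for the assignment `mem[a] := e`. -/
def store (a e : Expr ν) : Cmd :=
  .seq (a.compile L.reg L.scratch)
    (.seq (e.compile L.reg (L.scratch + 1)) (.store L.scratch (L.scratch + 1)))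

/-- The program for the loop `for i := 0, …, e - 1 do P`. -/
def forLoop (i : ν) (e : Expr ν) (P : Cmd) : Cmd :=
  let test := ((Expr.var i).lt e).compile L.reg L.scratch
  .seq (L.assign i 0) (.seq test
    (.loop L.scratch (.seq P (.seq (L.assign i (.var i + 1)) test))))

/-- The program for the loop `for i := 0, …, e - 1 do mem[a + i] := b`. -/
def fill (i : ν) (a e b : Expr ν) : Cmd :=
  L.forLoop i e (L.store (a + .var i) b)

variable {L} {M K : ℕ} {σ τ ρ : Store ν} {u u' : State} {P Q : Cmd} {T T' : ℕ}

theorem Represents.of_agreeBelow (h : L.Represents M σ u) (hu : u.AgreeBelow L.scratch u') :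
    L.Represents M σ u' where
  reg_low r hr := (hu.reg r (hr.trans_le (Nat.le_add_right _ _))).trans (h.reg_low r hr)
  reg_var x := (hu.reg _ (L.reg_lt_scratch x)).trans (h.reg_var x)
  mem_eq := hu.mem.trans h.mem_eq
  bounded := h.bounded

theorem Represents.setMem (h : L.Represents M σ u) (a : ℕ) {v : ℕ} (hv : v < M) :
    L.Represents M (σ.write a v) (u.setMem a v) where
  reg_low := h.reg_low
  reg_var := h.reg_var
  mem_eq := by simp only [State.setMem, Store.write, h.mem_eq]
  bounded := h.bounded.write a hv

theorem Represents.exec_compile (h : L.Represents M σ u) {e : Expr ν} (hK : e.weight ≤ K) {t : ℕ}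
    (ht : L.scratch ≤ t) :
    ∃ u', Exec (M ^ K) (e.compile L.reg t) u u' e.size ∧ u'.reg t = e.eval σ ∧
      u.AgreeBelow t u' := by
  have hM : 0 < M := two_pos.trans_le h.bounded.two_le
  exact e.exec_compile h.bounded (Nat.pow_le_pow_right hM hK)
    (fun x => (L.reg_lt_scratch x).trans_le ht) h.reg_var h.mem_eq

theorem Runs.mono (h : L.Runs M K P σ τ T) (hT : T ≤ T') : L.Runs M K P σ τ T' := fun u hu => by
  obtain ⟨u', t, hexec, ht, hu'⟩ := h u hu
  exact ⟨u', t, hexec, ht.trans hT, hu'⟩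

theorem Runs.seq (hP : L.Runs M K P σ τ T) (hQ : L.Runs M K Q τ ρ T') :
    L.Runs M K (.seq P Q) σ ρ (T + T') := fun u hu => by
  obtain ⟨u₁, t₁, h₁, ht₁, hu₁⟩ := hP u hu
  obtain ⟨u₂, t₂, h₂, ht₂, hu₂⟩ := hQ u₁ hu₁
  exact ⟨u₂, t₁ + t₂, .seq _ _ _ _ _ _ _ h₁ h₂, Nat.add_le_add ht₁ ht₂, hu₂⟩

theorem Runs.store {a e : Expr ν} {A v : ℕ} (ha : a.weight ≤ K) (he : e.weight ≤ K)
    (haddr : a.eval σ = A) (hval : e.eval σ = v) (hM : v < M) :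
    L.Runs M K (L.store a e) σ (σ.write A v) (a.size + (e.size + 1)) := fun u hu => by
  obtain ⟨u₁, h₁, hval₁, hu₁⟩ := hu.exec_compile ha le_rfl
  have hrep₁ := hu.of_agreeBelow hu₁
  obtain ⟨u₂, h₂, hval₂, hu₂⟩ := hrep₁.exec_compile he (Nat.le_succ L.scratch)
  have hrep₂ := hrep₁.of_agreeBelow
    ⟨fun r hr => hu₂.reg r (hr.trans (Nat.lt_succ_self _)), hu₂.mem⟩
  have h₃ := Exec.store (W := M ^ K) u₂ L.scratch (L.scratch + 1)
  rw [hu₂.reg _ (Nat.lt_succ_self _), hval₁, hval₂, haddr, hval] at h₃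
  exact ⟨_, _, .seq _ _ _ _ _ _ _ h₁ (.seq _ _ _ _ _ _ _ h₂ h₃), le_rfl, hrep₂.setMem _ hM⟩

variable [DecidableEq ν]

theorem Represents.setReg (h : L.Represents M σ u) (x : ν) {v : ℕ} (hv : v < M) :
    L.Represents M (σ.set x v) (u.setReg (L.reg x) v) where
  reg_low r hr :=
    (State.reg_setReg_of_ne _ _ (hr.trans_le (Nat.le_add_right _ _)).ne).trans (h.reg_low r hr)
  reg_var y := by simp only [State.reg_setReg, Store.var_set, L.reg_injective.eq_iff, h.reg_var]
  mem_eq := h.mem_eq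
  bounded := h.bounded.set x hv

theorem Runs.assign {x : ν} {e : Expr ν} {v : ℕ} (hK : e.weight ≤ K) (hval : e.eval σ = v)
    (hM : v < M) : L.Runs M K (L.assign x e) σ (σ.set x v) (e.size + 1) := fun u hu => by
  obtain ⟨u₁, h₁, hval₁, hu₁⟩ := hu.exec_compile hK le_rfl
  have hand : BinOp.and.eval (u₁.reg L.scratch) (u₁.reg L.scratch) = v := by
    simp only [BinOp.eval, Nat.and_self, hval₁, hval]
  have hlt : e.eval σ < M ^ K := (e.eval_lt_pow_weight hu.bounded).trans_le
    (Nat.pow_le_pow_right (two_pos.trans_le hu.bounded.two_le) hK)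
  have h₂ := Exec.op u₁ .and (L.reg x) L.scratch L.scratch ((hand.trans hval.symm).trans_lt hlt)
  rw [hand] at h₂
  exact ⟨_, _, .seq _ _ _ _ _ _ _ h₁ h₂, le_rfl, (hu.of_agreeBelow hu₁).setReg x hM⟩

section ForLoop

variable {i : ν} {e : Expr ν} {R : ℕ → Store ν} {N : ℕ}

theorem Runs.increment (hK : 3 ≤ K) {k : ℕ} (hk : k + 1 < M) :
    L.Runs M K (L.assign i (.var i + 1)) (σ.set i k) (σ.set i (k + 1)) 4 := by
  have hassign := Runs.assign (L := L) (x := i) (e := .var i + 1) (K := K) (σ := σ.set i k)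
    (by simpa only [Expr.weight] using hK) (by simp) hk
  rwa [Store.set_set] at hassign

theorem Runs.exec_loop (he : e.weight + 3 ≤ K) (hN : N < M)
    (hbound : ∀ k ≤ N, e.eval ((R k).set i k) = N)
    (hP : ∀ k < N, L.Runs M K P ((R k).set i k) ((R (k + 1)).set i k) T) {k : ℕ} (hk : k ≤ N)
    (hu : L.Represents M ((R k).set i k) u) (htest : u.reg L.scratch = if k < N then 1 else 0) :
    ∃ u' t, Exec (M ^ K) (.loop L.scratch (.seq P (.seq (L.assign i (.var i + 1))
        (((Expr.var i).lt e).compile L.reg L.scratch)))) u u' t ∧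
      t ≤ (N - k) * (T + e.size + 7) + 1 ∧ L.Represents M ((R N).set i N) u' := by
  induction hj : N - k generalizing k u with
  | zero =>
    obtain rfl : k = N := by omega
    exact ⟨u, 1, .loopDone _ _ _ (by simpa using htest), by simp, hu⟩
  | succ j ih =>
    have hkN : k < N := by omega
    obtain ⟨u₁, t₁, h₁, ht₁, hu₁⟩ := hP k hkN u hu
    obtain ⟨u₂, t₂, h₂, ht₂, hu₂⟩ := Runs.increment (K := K) (by omega) (by omega) u₁ hu₁
    obtain ⟨u₃, h₃, hval, hu₃⟩ := hu₂.exec_compile (e := (Expr.var i).lt e) (K := K)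
      (by simp only [Expr.lt, Expr.weight]; omega) le_rfl
    obtain ⟨u₄, t₄, h₄, ht₄, hu₄⟩ := ih (k := k + 1) hkN (hu₂.of_agreeBelow hu₃)
      (by simp [hval, hbound (k + 1) hkN]) (by omega)
    refine ⟨u₄, _, .loopStep _ _ _ _ _ _ _ (by simp [htest, hkN])
      (.seq _ _ _ _ _ _ _ h₁ (.seq _ _ _ _ _ _ _ h₂ h₃)) h₄, ?_, hu₄⟩
    have hsize : ((Expr.var i).lt e).size = 1 + (e.size + 1) := rfl
    rw [hsize]
    linarith [Nat.succ_mul j (T + e.size + 7)]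

theorem Runs.forLoop (he : e.weight + 3 ≤ K) (hN : N < M)
    (hbound : ∀ k ≤ N, e.eval ((R k).set i k) = N)
    (hP : ∀ k < N, L.Runs M K P ((R k).set i k) ((R (k + 1)).set i k) T) :
    L.Runs M K (L.forLoop i e P) (R 0) ((R N).set i N) ((N + 1) * (T + e.size + 7)) :=
  fun u hu => by
  have hinit : L.Runs M K (L.assign i 0) (R 0) ((R 0).set i 0) 2 :=
    Runs.assign (Nat.zero_le K) rfl (Nat.zero_lt_of_lt hN)
  obtain ⟨u₁, t₁, h₁, ht₁, hu₁⟩ := hinit u hu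
  obtain ⟨u₂, h₂, hval, hu₂⟩ := hu₁.exec_compile (e := (Expr.var i).lt e) (K := K)
    (by simp only [Expr.lt, Expr.weight]; omega) le_rfl
  obtain ⟨u₃, t₃, h₃, ht₃, hu₃⟩ := Runs.exec_loop he hN hbound hP (Nat.zero_le N)
    (hu₁.of_agreeBelow hu₂) (by
      rw [hval, Expr.eval_lt, hbound 0 (Nat.zero_le N)]
      simp)
  refine ⟨u₃, _, .seq _ _ _ _ _ _ _ h₁ (.seq _ _ _ _ _ _ _ h₂ h₃), ?_, hu₃⟩
  have hsize : ((Expr.var i).lt e).size = 1 + (e.size + 1) := rfl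
  rw [hsize]
  rw [Nat.sub_zero] at ht₃
  linarith [Nat.succ_mul N (T + e.size + 7)]

theorem Runs.fill {a b : Expr ν} {A : ℕ} {v : ℕ → ℕ} (ha : a.weight + 2 ≤ K)
    (he : e.weight + 3 ≤ K) (hb : b.weight ≤ K) (hN : N < M)
    (haddr : ∀ k < N, a.eval ((σ.overwrite A k v).set i k) = A)
    (hbound : ∀ k ≤ N, e.eval ((σ.overwrite A k v).set i k) = N)
    (hval : ∀ k < N, b.eval ((σ.overwrite A k v).set i k) = v k) (hv : ∀ k < N, v k < M) :
    L.Runs M K (L.fill i a e b) σ ((σ.overwrite A N v).set i N)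
      ((N + 1) * (a.size + b.size + e.size + 10)) := by
  have hbody : ∀ k < N, L.Runs M K (L.store (a + .var i) b) ((σ.overwrite A k v).set i k)
      ((σ.overwrite A (k + 1) v).set i k) (a.size + b.size + 3) := by
    intro k hk
    have hstore := Runs.store (L := L) (K := K) (a := a + .var i)
      (by simpa only [Expr.weight] using ha) hb
      (by rw [Expr.eval_add, haddr k hk, Expr.eval_var, Store.var_set, if_pos rfl])
      (hval k hk) (hv k hk)
    rw [Store.write_overwrite] at hstore
    exact hstore.mono (by change a.size + (1 + 1) + (b.size + 1) ≤ _; omega)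
  have hloop := Runs.forLoop he hN hbound hbody
  rw [Store.overwrite_zero] at hloop
  exact hloop.mono (le_of_eq (by ring))

end ForLoop

end Layout

end WordRAM

namespace PartialDom

/-! ### Reading off disjoint neighborhoods from the optimum -/

theorem IsEdgeList.ncard_edgeSet {n : ℕ} {G : SimpleGraph (Fin n)} {E : List (Fin n × Fin n)}
    (h : IsEdgeList G E) : G.edgeSet.ncard = E.length := by
  have hset : G.edgeSet = (E.map fun e => s(e.1, e.2)).toFinset := by
    ext e
    rw [List.coe_toFinset]
    exact (h.2 e).symm
  rw [hset, Set.ncard_coe_finset, List.toFinset_card_of_nodup h.1, List.length_map]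

section Optimum

variable {V : Type*} [Finite V] {G : SimpleGraph V}

theorem exists_isOptimum [Nonempty V] (G : SimpleGraph V) : ∃ t, IsOptimum G t := by
  let f : V × V → ℕ := fun p => (closedNbhd G p.1 ∪ closedNbhd G p.2).ncard
  obtain ⟨p, hp⟩ := Finite.exists_max f
  refine ⟨f p, ⟨p.1, p.2, rfl⟩, ?_⟩
  rintro _ ⟨x₁, x₂, rfl⟩
  exact hp (x₁, x₂)

theorem IsOptimum.eq_two_mul_iff {t K : ℕ} (ht : IsOptimum G t) {S : Set V}
    (hmem : ∀ v ∈ S, (closedNbhd G v).ncard = K) (hnotMem : ∀ v ∉ S, (closedNbhd G v).ncard < K) :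
    t = 2 * K ↔ ∃ v ∈ S, ∃ w ∈ S, Disjoint (closedNbhd G v) (closedNbhd G w) := by
  have hle : ∀ v, (closedNbhd G v).ncard ≤ K := fun v => by
    by_cases hv : v ∈ S
    exacts [(hmem v hv).le, (hnotMem v hv).le]
  obtain ⟨⟨v, w, htvw⟩, hmax⟩ := ht
  have hunion := Set.ncard_union_add_ncard_inter (closedNbhd G v) (closedNbhd G w)
  constructor
  · intro h
    refine ⟨v, ?_, w, ?_, ?_⟩
    · by_contra hv
      linarith [hnotMem v hv, hle w]
    · by_contra hw
      linarith [hnotMem w hw, hle v]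
    · rw [Set.disjoint_iff_inter_eq_empty, ← Set.ncard_eq_zero]
      linarith [hle v, hle w]
  · rintro ⟨v', hv', w', hw', hdisj⟩
    have hbound := hmax ⟨v', w', rfl⟩
    rw [Set.ncard_union_eq hdisj, hmem v' hv', hmem w' hw'] at hbound
    linarith [hle v, hle w]

end Optimum

/-- Points `x : X`, each of which is joined to the vertices `link x i`.  The paper's reduction
produces a bipartite graph of this kind. -/
structure Incidence (X I V : Type*) where
  point : X ↪ V
  link : X → I ↪ V
  point_ne_link : ∀ x x' i, point x ≠ link x' i

namespace Incidence

variable {X I V : Type*} (S : Incidence X I V)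

/-- The graph of an incidence structure. -/
def graph : SimpleGraph V :=
  SimpleGraph.fromEdgeSet (Set.range fun p : X × I => s(S.point p.1, S.link p.1 p.2))

variable {S}

theorem mk_point_link_injective :
    Function.Injective fun p : X × I => s(S.point p.1, S.link p.1 p.2) := by
  rintro ⟨x, i⟩ ⟨x', i'⟩ h
  rcases Sym2.eq_iff.1 h with ⟨hx, hi⟩ | ⟨hx, -⟩
  · obtain rfl := S.point.injective hx
    exact Prod.ext rfl ((S.link x).injective hi)
  · exact absurd hx (S.point_ne_link x x' i')

theorem mem_edgeSet_graph {e : Sym2 V} :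
    e ∈ S.graph.edgeSet ↔ ∃ p : X × I, s(S.point p.1, S.link p.1 p.2) = e := by
  rw [graph, SimpleGraph.edgeSet_fromEdgeSet, Set.mem_sdiff, Set.mem_range, and_iff_left_iff_imp]
  rintro ⟨p, rfl⟩ hdiag
  exact S.point_ne_link _ _ _ hdiag

theorem graph_adj {v w : V} :
    S.graph.Adj v w ↔ ∃ x i, v = S.point x ∧ w = S.link x i ∨ v = S.link x i ∧ w = S.point x := by
  rw [← SimpleGraph.mem_edgeSet, mem_edgeSet_graph, Prod.exists]
  simp only [Sym2.eq_iff, eq_comm]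

theorem neighborSet_point (x : X) : S.graph.neighborSet (S.point x) = Set.range (S.link x) := by
  ext w
  rw [SimpleGraph.mem_neighborSet, graph_adj]
  constructor
  · rintro ⟨x', i, ⟨hx, rfl⟩ | ⟨hx, -⟩⟩
    · exact ⟨i, by rw [S.point.injective hx]⟩
    · exact absurd hx (S.point_ne_link _ _ _)
  · rintro ⟨i, rfl⟩
    exact ⟨x, i, .inl ⟨rfl, rfl⟩⟩

theorem neighborSet_of_notMem_range_point {v : V} (hv : v ∉ Set.range S.point) :
    S.graph.neighborSet v = S.point '' {x | v ∈ Set.range (S.link x)} := by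
  ext w
  rw [SimpleGraph.mem_neighborSet, graph_adj]
  constructor
  · rintro ⟨x, i, ⟨rfl, -⟩ | ⟨rfl, rfl⟩⟩
    · exact absurd ⟨x, rfl⟩ hv
    · exact ⟨x, ⟨i, rfl⟩, rfl⟩
  · rintro ⟨x, ⟨i, rfl⟩, rfl⟩
    exact ⟨x, i, .inr ⟨rfl, rfl⟩⟩

theorem ncard_closedNbhd_point [Finite I] (x : X) :
    (closedNbhd S.graph (S.point x)).ncard = Nat.card I + 1 := by
  rw [closedNbhd, neighborSet_point, Set.ncard_insert_of_notMem, Set.ncard_range_of_injective]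
  · exact (S.link x).injective
  · rintro ⟨i, hi⟩
    exact S.point_ne_link x x i hi.symm

theorem ncard_closedNbhd_lt [Finite V] {K : ℕ} {v : V} (hv : v ∉ Set.range S.point)
    (hK : {x | v ∈ Set.range (S.link x)}.ncard < K) :
    (closedNbhd S.graph v).ncard < K + 1 := by
  have : Finite X := Finite.of_injective _ S.point.injective
  calc (closedNbhd S.graph v).ncard
    _ ≤ (S.graph.neighborSet v).ncard + 1 := Set.ncard_insert_le _ _
    _ ≤ {x | v ∈ Set.range (S.link x)}.ncard + 1 := by
      rw [neighborSet_of_notMem_range_point hv]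
      gcongr
      exact Set.ncard_image_le
    _ < K + 1 := by gcongr

theorem disjoint_closedNbhd_point_iff [Nonempty I] (x x' : X) :
    Disjoint (closedNbhd S.graph (S.point x)) (closedNbhd S.graph (S.point x')) ↔
      Disjoint (Set.range (S.link x)) (Set.range (S.link x')) := by
  simp only [closedNbhd, neighborSet_point, Set.disjoint_insert_left, Set.disjoint_insert_right,
    Set.mem_insert_iff, Set.mem_range, (S.point_ne_link _ _ _).symm, S.point.injective.eq_iff,
    exists_false, or_false, not_false_eq_true, true_and, and_iff_right_iff_imp]
  rintro hdisj rfl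
  obtain ⟨i⟩ := ‹Nonempty I›
  exact Set.disjoint_left.1 hdisj ⟨i, rfl⟩ ⟨i, rfl⟩

theorem isOptimum_eq_iff [Finite V] [Finite I] [Nonempty I] {t : ℕ}
    (hdeg : ∀ v, {x | v ∈ Set.range (S.link x)}.ncard < Nat.card I) (ht : IsOptimum S.graph t) :
    t = 2 * (Nat.card I + 1) ↔ ∃ x x', Disjoint (Set.range (S.link x)) (Set.range (S.link x')) := by
  have hpoint : ∀ v ∈ Set.range S.point, (closedNbhd S.graph v).ncard = Nat.card I + 1 := by
    rintro _ ⟨x, rfl⟩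
    exact ncard_closedNbhd_point x
  rw [ht.eq_two_mul_iff hpoint fun v hv => ncard_closedNbhd_lt hv (hdeg v)]
  simp only [Set.exists_range_iff, disjoint_closedNbhd_point_iff]

/-- The edges of an incidence structure, in the order given by a numbering of the flags. -/
def edgeList {n m : ℕ} (S : Incidence X I (Fin n)) (e : Fin m ≃ X × I) : List (Fin n × Fin n) :=
  List.ofFn fun k => (S.point (e k).1, S.link (e k).1 (e k).2)

theorem isEdgeList_edgeList {n m : ℕ} (S : Incidence X I (Fin n)) (e : Fin m ≃ X × I) :
    IsEdgeList S.graph (S.edgeList e) := by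
  rw [IsEdgeList, edgeList, List.map_ofFn]
  refine ⟨List.nodup_ofFn.2 (mk_point_link_injective.comp e.injective), fun a => ?_⟩
  rw [List.mem_ofFn, mem_edgeSet_graph]
  exact (e.surjective.exists (p := fun p => s(S.point p.1, S.link p.1 p.2) = a)).symm

end Incidence

/-! ### The gadget -/

section Gadget

variable {X Γ Y : Type*} [LinearOrder Γ]

/-- The gadget vertex that the point `x` with group `γ x` and bits `b x` is joined to on behalf of
the group `p.1` and the coordinate `p.2`.  A `1` leads to the vertex of an unordered pair of groups,
where points of both groups meet, and a `0` to the vertex of an ordered pair, which belongs to the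
first group. -/
def gadget (γ : X → Γ) (b : X → Y → Bool) (x : X) (p : Γ × Y) : ((Γ × Γ) × Y) × Fin 2 :=
  if b x p.2 then (((min (γ x) p.1, max (γ x) p.1), p.2), 1) else (((γ x, p.1), p.2), 0)

variable {γ : X → Γ} {b : X → Y → Bool}

theorem gadget_injective (x : X) : Function.Injective (gadget γ b x) := by
  rintro ⟨g, y⟩ ⟨g', y'⟩ h
  have hy : y = y' := by
    have := congrArg (fun v => v.1.2) h
    simp only [gadget] at this
    split_ifs at this <;> exact this
  subst hy
  simp only [gadget] at h
  split_ifs at h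
  · simp only [Prod.mk.injEq, and_true] at h ⊢
    grind
  · simpa using h

theorem disjoint_range_gadget_iff {x x' : X}
    (hγ : γ x = γ x' → ∃ y, b x y ∧ b x' y) :
    Disjoint (Set.range (gadget γ b x)) (Set.range (gadget γ b x')) ↔ ¬ ∃ y, b x y ∧ b x' y := by
  rw [← not_iff_not, not_not, Set.not_disjoint_iff]
  constructor
  · rintro ⟨_, ⟨⟨g, y⟩, rfl⟩, ⟨g', y'⟩, h⟩
    simp only [gadget] at h
    split_ifs at h with hx' hx hx
    · simp only [Prod.mk.injEq] at h
      exact ⟨y, hx, h.1.2 ▸ hx'⟩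
    · simp at h
    · simp at h
    · simp only [Prod.mk.injEq] at h
      exact hγ h.1.1.1.symm
  · rintro ⟨y, hy, hy'⟩
    refine ⟨_, ⟨(γ x', y), rfl⟩, (γ x, y), ?_⟩
    simp only [gadget, hy, hy', if_true, min_comm, max_comm]

theorem setOf_mem_range_gadget_subset (v : ((Γ × Γ) × Y) × Fin 2) :
    {x | v ∈ Set.range (gadget γ b x)} ⊆ γ ⁻¹' {v.1.1.1, v.1.1.2} := by
  rintro x ⟨p, rfl⟩
  simp only [gadget, Set.mem_preimage, Set.mem_insert_iff, Set.mem_singleton_iff]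
  split_ifs
  · exact (le_total (γ x) p.1).imp (fun h => (min_eq_left h).symm) fun h => (max_eq_left h).symm
  · exact .inl rfl

theorem ncard_setOf_mem_range_gadget_le [Finite X] {s : ℕ} (hs : ∀ g, (γ ⁻¹' {g}).ncard ≤ s)
    (v : ((Γ × Γ) × Y) × Fin 2) : {x | v ∈ Set.range (gadget γ b x)}.ncard ≤ 2 * s :=
  calc {x | v ∈ Set.range (gadget γ b x)}.ncard
    _ ≤ (γ ⁻¹' {v.1.1.1} ∪ γ ⁻¹' {v.1.1.2}).ncard :=
      Set.ncard_le_ncard (setOf_mem_range_gadget_subset v)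
    _ ≤ (γ ⁻¹' {v.1.1.1}).ncard + (γ ⁻¹' {v.1.1.2}).ncard := Set.ncard_union_le _ _
    _ ≤ 2 * s := by linarith [hs v.1.1.1, hs v.1.1.2]

end Gadget

section GadgetIncidence

variable {r s D : ℕ}

/-- A numbering of the gadget vertices of `r` groups and `D` coordinates. -/
def gadgetIndex : ((Fin r × Fin r) × Fin D) × Fin 2 ≃ Fin (r * r * D * 2) :=
  (((finProdFinEquiv.prodCongr (.refl _)).trans finProdFinEquiv).prodCongr (.refl _)).trans
    finProdFinEquiv

/-- The numbering of the flags by which the edges are listed. -/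
def flagIndex : Fin (r * s * (r * D)) ≃ (Fin r × Fin s) × (Fin r × Fin D) :=
  finProdFinEquiv.symm.trans (finProdFinEquiv.symm.prodCongr finProdFinEquiv.symm)

/-- The reduction's graph for points that are divided into `r` groups of size `s` and carry `D` bits
each.  The points are numbered group by group, and the gadget vertices follow them. -/
def gadgetIncidence (b : Fin r × Fin s → Fin D → Bool) :
    Incidence (Fin r × Fin s) (Fin r × Fin D) (Fin (r * s + r * r * D * 2)) where
  point := finProdFinEquiv.toEmbedding.trans (Fin.castAddEmb _)
  link x := ⟨fun p => Fin.natAdd _ (gadgetIndex (gadget Prod.fst b x p)), fun _ _ h =>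
    gadget_injective x (gadgetIndex.injective (Fin.natAdd_injective _ _ h))⟩
  point_ne_link x x' i h := by
    have hval : (finProdFinEquiv x : ℕ) =
      r * s + (gadgetIndex (gadget Prod.fst b x' i) : ℕ) := congrArg Fin.val h
    exact absurd (finProdFinEquiv x).isLt (by omega)

variable {b : Fin r × Fin s → Fin D → Bool}

/-- The pair of groups is ordered by truncated subtraction: `max g h = h + (g - h)` and
`min g h = g - (g - h)`. -/
theorem val_gadgetIncidence_link (x : Fin r × Fin s) (h : Fin r) (y : Fin D) :
    let β := (b x y).toNat * (x.1 - h)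
    ((gadgetIncidence b).link x (h, y) : ℕ) =
      r * s + ((b x y).toNat + 2 * (y + D * (h + β + r * (x.1 - β)))) := by
  intro β
  change r * s + (gadgetIndex (gadget Prod.fst b x (h, y)) : ℕ) = _
  congr 1
  cases hbit : b x y <;>
    simp only [gadget, gadgetIndex, β, hbit, if_true, Bool.false_eq_true, if_false,
      Bool.toNat_true, Bool.toNat_false, one_mul, zero_mul]
  · rfl
  · change 1 + 2 * (y + D * ((max x.1 h : Fin r) + r * (min x.1 h : Fin r))) = _
    have hmax : ((max x.1 h : Fin r) : ℕ) = h + (x.1 - h) := by grind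
    have hmin : ((min x.1 h : Fin r) : ℕ) = x.1 - (x.1 - h : ℕ) := by grind
    rw [hmax, hmin]

theorem disjoint_range_gadgetIncidence_link_iff {x x' : Fin r × Fin s} :
    Disjoint (Set.range ((gadgetIncidence b).link x)) (Set.range ((gadgetIncidence b).link x')) ↔
      Disjoint (Set.range (gadget Prod.fst b x)) (Set.range (gadget Prod.fst b x')) := by
  have hrange : ∀ x, Set.range ((gadgetIncidence b).link x) =
      (Fin.natAdd _ ∘ gadgetIndex) '' Set.range (gadget Prod.fst b x) := fun x => by
    rw [← Set.range_comp]
    rfl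
  rw [hrange, hrange, Set.disjoint_image_iff]
  exact (Fin.natAdd_injective _ _).comp gadgetIndex.injective

theorem ncard_setOf_mem_range_gadgetIncidence_link_le (v : Fin (r * s + r * r * D * 2)) :
    {x | v ∈ Set.range ((gadgetIncidence b).link x)}.ncard ≤ 2 * s := by
  have hgroup : ∀ g : Fin r, (Prod.fst ⁻¹' {g} : Set (Fin r × Fin s)).ncard ≤ s := fun g => by
    rw [← Set.prod_univ, Set.ncard_prod, Set.ncard_singleton, Set.ncard_univ, Nat.card_fin, one_mul]
  obtain ⟨w, hw⟩ | hv := em (∃ w, Fin.natAdd _ (gadgetIndex w) = v)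
  · refine le_trans (Set.ncard_le_ncard ?_) (ncard_setOf_mem_range_gadget_le (b := b) hgroup w)
    rintro x ⟨p, hp⟩
    exact ⟨p, gadgetIndex.injective (Fin.natAdd_injective _ _ (hp.trans hw.symm))⟩
  · have hempty : {x | v ∈ Set.range ((gadgetIncidence b).link x)} = ∅ :=
      Set.eq_empty_of_forall_notMem fun x ⟨p, hp⟩ => hv ⟨_, hp⟩
    rw [hempty, Set.ncard_empty]
    exact Nat.zero_le _

theorem isOptimum_gadgetIncidence_eq_iff {t : ℕ} (hrD : 2 * s < r * D)
    (hb : ∀ x x', x.1 = x'.1 → ∃ y, b x y ∧ b x' y)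
    (ht : IsOptimum (gadgetIncidence b).graph t) :
    t = 2 * (r * D + 1) ↔ ∃ x x', ¬ ∃ y, b x y ∧ b x' y := by
  have hcard : Nat.card (Fin r × Fin D) = r * D := by simp
  have : Nonempty (Fin r × Fin D) := Nat.card_pos_iff.1 (by omega) |>.1
  rw [← hcard, Incidence.isOptimum_eq_iff (fun v => ?_) ht]
  · simp only [disjoint_range_gadgetIncidence_link_iff, disjoint_range_gadget_iff (hb _ _)]
  · rw [hcard]
    exact (ncard_setOf_mem_range_gadgetIncidence_link_le v).trans_lt hrD

end GadgetIncidence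

end PartialDom

/-! ### The encodings of the instances -/

section Encodings

open WordRAM

namespace WordRAM

theorem initState_mem_lt {x : List ℕ} {M : ℕ} (hM : 0 < M) (hx : ∀ v ∈ x, v < M) (a : ℕ) :
    (initState x).mem a < M := by
  obtain ha | ha := lt_or_ge a x.length
  · exact (List.getD_eq_getElem x 0 ha).trans_lt (hx _ (List.getElem_mem ha))
  · exact (List.getD_eq_default x 0 ha).trans_lt hM

theorem inputSize_le {x : List ℕ} {M : ℕ} (hx : ∀ v ∈ x, v ≤ M) :
    inputSize x ≤ x.length + M + 2 := by
  have hmax : x.foldr max 0 ≤ M := by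
    induction x with
    | nil => exact Nat.zero_le M
    | cons v x ih => exact max_le (hx v List.mem_cons_self) (ih fun w hw => hx w (.tail v hw))
  exact Nat.add_le_add_right (Nat.add_le_add_left hmax _) 2

end WordRAM

namespace PartialDom

theorem getElem?_flatMap_pair {α β : Type*} (l : List α) (f g : α → β) (i : ℕ) :
    (l.flatMap fun a => [f a, g a])[i]? = l[i / 2]?.map (if i % 2 = 0 then f else g) := by
  induction l generalizing i with
  | nil => rfl
  | cons a l ih =>
    match i with
    | 0 | 1 => rfl
    | i + 2 =>
      have hdiv : (i + 2) / 2 = i / 2 + 1 := by omega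
      have hmod : (i + 2) % 2 = i % 2 := by omega
      simp only [List.flatMap_cons, hdiv, hmod, List.getElem?_cons_succ, ← ih]
      rfl

variable {n : ℕ}

theorem length_encode (E : List (Fin n × Fin n)) : (encode E).length = 2 * E.length + 2 := by
  simp only [encode, List.length_cons, List.length_flatMap, List.length_nil, List.map_const',
    List.sum_replicate, smul_eq_mul, zero_add]
  ring

theorem le_length_of_mem_encode {E : List (Fin n × Fin n)} (hE : n ≤ E.length) {v : ℕ}
    (hv : v ∈ encode E) : v ≤ E.length := by
  simp only [encode, List.mem_cons, List.mem_flatMap, List.not_mem_nil, or_false] at hv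
  obtain rfl | rfl | ⟨e, -, rfl | rfl⟩ := hv
  exacts [hE, le_rfl, e.1.isLt.le.trans hE, e.2.isLt.le.trans hE]

theorem inputSize_encode_le {E : List (Fin n × Fin n)} (hE : n ≤ E.length) (h : 4 ≤ E.length) :
    inputSize (encode E) ≤ 4 * E.length := by
  have hsize := inputSize_le fun _ => le_length_of_mem_encode hE
  rw [length_encode] at hsize
  omega

theorem initState_encode_mem_eq_zero {E : List (Fin n × Fin n)} {a : ℕ}
    (ha : 2 * E.length + 2 ≤ a) : (initState (encode E)).mem a = 0 :=
  List.getD_eq_default _ _ (by rwa [length_encode])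

theorem initState_encode_ofFn_mem_add_two {m k : ℕ} (f : Fin m → Fin n × Fin n)
    (hk : k / 2 < m) :
    (initState (encode (List.ofFn f))).mem (k + 2) =
      if k % 2 = 0 then ((f ⟨k / 2, hk⟩).1 : ℕ) else (f ⟨k / 2, hk⟩).2 := by
  simp only [initState, encode, List.getD_eq_getElem?_getD, List.getElem?_cons_succ,
    getElem?_flatMap_pair, List.getElem?_ofFn, dif_pos hk, Option.map_some, Option.getD_some]
  split_ifs <;> rfl

end PartialDom

namespace OV

variable {n d : ℕ} (A B : Fin n → Fin d → Bool)

theorem encodeVectors_eq_ofFn :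
    encodeVectors A = List.ofFn fun k : Fin (n * d) => (A k.divNat k.modNat).toNat := by
  rw [encodeVectors, List.ofFn_mul]
  congr! 6 with i y
  have hindex (h : (i : ℕ) * d + y < n * d) : ⟨i * d + y, h⟩ = finProdFinEquiv (i, y) :=
    Fin.ext (by rw [finProdFinEquiv_apply_val]; ring)
  rw [hindex]
  exact (congrArg (fun x : Fin n × Fin d => A x.1 x.2)
    (finProdFinEquiv.symm_apply_apply (i, y))).symm

theorem length_encodeVectors : (encodeVectors A).length = n * d := by
  rw [encodeVectors_eq_ofFn, List.length_ofFn]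

theorem getD_encodeVectors (i : Fin n) (y : Fin d) :
    (encodeVectors A).getD (i * d + y) 0 = (A i y).toNat := by
  have hlt := (finProdFinEquiv (i, y)).isLt
  rw [add_comm, mul_comm, ← finProdFinEquiv_apply_val (i, y), encodeVectors_eq_ofFn,
    List.getD_eq_getElem _ _ (by rwa [List.length_ofFn]), List.getElem_ofFn]
  exact congrArg (fun x : Fin n × Fin d => (A x.1 x.2).toNat)
    (finProdFinEquiv.symm_apply_apply (i, y))

variable {A B}

theorem initState_encode_mem_vector (f : Fin 2) (i : Fin n) (y : Fin d) :
    (initState (encode A B)).mem ((f * n + i) * d + y + 2) = (![A, B] f i y).toNat := by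
  have hlt : i * d + y < n * d := (finProdFinEquiv (i, y)).isLt.trans_eq' (by simp; ring)
  simp only [initState, encode, List.getD_cons_succ]
  match f with
  | 0 =>
    rw [List.getD_append _ _ _ _ (by simpa [length_encodeVectors] using hlt)]
    simpa using getD_encodeVectors A i y
  | 1 =>
    have haddr : ((1 : Fin 2) * n + i) * d + y = n * d + (i * d + y) := by simp; ring
    rw [haddr, List.getD_append_right _ _ _ _ (by simp [length_encodeVectors]),
      length_encodeVectors, Nat.add_sub_cancel_left]
    exact getD_encodeVectors B i y

theorem initState_encode_mem_eq_zero {a : ℕ} (ha : 2 * n * d + 2 ≤ a) :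
    (initState (encode A B)).mem a = 0 := by
  refine List.getD_eq_default _ _ ?_
  simp only [encode, List.length_cons, List.length_append, length_encodeVectors]
  linarith

theorem le_of_mem_encode {v : ℕ} (hv : v ∈ encode A B) : v ≤ n + d + 1 := by
  simp only [encode, encodeVectors_eq_ofFn, List.mem_cons, List.mem_append, List.mem_ofFn] at hv
  obtain rfl | rfl | ⟨k, rfl⟩ | ⟨k, rfl⟩ := hv
  · omega
  · omega
  all_goals exact (Bool.toNat_le _).trans (Nat.le_add_left _ _)

theorem add_four_le_inputSize_encode :
    n + 4 ≤ inputSize (encode A B) ∧ d + 4 ≤ inputSize (encode A B) := by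
  simp only [inputSize, encode, List.length_cons, List.foldr_cons]
  omega

end OV

end Encodings

/-! ### The reduction -/

namespace OV

section Combinatorics

variable {n d : ℕ} (A B : Fin n → Fin d → Bool)

/-- The vector `p.2` of the family `p.1`, extended by the unit vector of this family. -/
def taggedVector (p : Fin 2 × Fin n) : Fin (d + 2) → Bool :=
  Fin.append (![A, B] p.1 p.2) fun f => decide (f = p.1)

variable {A B}

theorem exists_taggedVector_of_fst_eq {p q : Fin 2 × Fin n} (h : p.1 = q.1) :
    ∃ y, taggedVector A B p y ∧ taggedVector A B q y :=
  ⟨Fin.natAdd d p.1, by simp [taggedVector], by simp [taggedVector, h]⟩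

theorem exists_taggedVector_iff (i j : Fin n) :
    (∃ y, taggedVector A B (0, i) y ∧ taggedVector A B (1, j) y) ↔ ∃ y, A i y ∧ B j y := by
  constructor
  · rintro ⟨y, hA, hB⟩
    induction y using Fin.addCases with
    | left y => exact ⟨y, by simpa [taggedVector] using hA, by simpa [taggedVector] using hB⟩
    | right f => simp_all [taggedVector]
  · rintro ⟨y, hA, hB⟩
    exact ⟨Fin.castAdd 2 y, by simpa [taggedVector] using hA, by simpa [taggedVector] using hB⟩

theorem hasOrthogonalPair_iff_taggedVector :
    HasOrthogonalPair A B ↔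
      ∃ p q, ¬ ∃ y, taggedVector A B p y ∧ taggedVector A B q y := by
  have hsum (i j : Fin n) : ∑ y, (A i y).toNat * (B j y).toNat = 0 ↔ ¬ ∃ y, A i y ∧ B j y := by
    simp only [Finset.sum_eq_zero_iff, Finset.mem_univ, true_imp_iff, mul_eq_zero,
      Bool.toNat_eq_zero, ← Bool.not_eq_true, not_exists, not_and_or]
  simp only [HasOrthogonalPair, hsum, ← exists_taggedVector_iff]
  constructor
  · rintro ⟨i, j, h⟩
    exact ⟨(0, i), (1, j), h⟩
  · rintro ⟨⟨f, i⟩, ⟨g, j⟩, h⟩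
    have hfg : f ≠ g := fun hfg => h (exists_taggedVector_of_fst_eq hfg)
    match f, g with
    | 0, 0 | 1, 1 => exact absurd rfl hfg
    | 0, 1 => exact ⟨i, j, h⟩
    | 1, 0 => exact ⟨j, i, by simpa only [and_comm] using h⟩

/-- The size of the groups of vectors.  Adding `3` to the rounded square root makes sure that the
graph has at least as many edges as vertices. -/
def groupSize (n : ℕ) : ℕ := n.sqrt + 3

/-- The vector that is assigned to the `x.2`-th point of the group `x.1`.  The first half of the
groups belongs to the first family; within a family, the vectors are repeated cyclically. -/
def vectorOf [NeZero n] (x : Fin (2 * groupSize n) × Fin (groupSize n)) : Fin 2 × Fin n :=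
  (x.1.divNat, Fin.ofNat n (finProdFinEquiv x % (groupSize n * groupSize n)))

theorem le_groupSize_mul_self (n : ℕ) : n ≤ groupSize n * groupSize n := by
  have := Nat.lt_succ_sqrt n
  rw [groupSize]
  nlinarith

theorem vectorOf_surjective [NeZero n] : Function.Surjective (vectorOf (n := n)) := by
  rintro ⟨f, i⟩
  have hi : (i : ℕ) < groupSize n * groupSize n := i.isLt.trans_le (le_groupSize_mul_self n)
  let q := Fin.cast (mul_assoc 2 _ _).symm (finProdFinEquiv (f, (⟨i, hi⟩ : Fin (_ * _))))
  have hq : (q : ℕ) = i + groupSize n * groupSize n * f := by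
    rw [Fin.val_cast, finProdFinEquiv_apply_val]
  refine ⟨finProdFinEquiv.symm q, Prod.ext (Fin.ext ?_) (Fin.ext ?_)⟩
  · rw [vectorOf, Fin.coe_divNat, finProdFinEquiv_symm_apply, Fin.coe_divNat, hq,
      Nat.div_div_eq_div_mul, Nat.add_mul_div_left _ _ (Nat.zero_lt_of_lt hi), Nat.div_eq_of_lt hi,
      zero_add]
  · rw [vectorOf, Fin.val_ofNat, Equiv.apply_symm_apply, hq, Nat.add_mul_mod_self_left,
      Nat.mod_eq_of_lt hi, Nat.mod_eq_of_lt i.isLt]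

/-- The number of vertices of the reduction's graph. -/
abbrev numVertices (n d : ℕ) : ℕ :=
  2 * groupSize n * groupSize n + 2 * groupSize n * (2 * groupSize n) * (d + 2) * 2

/-- The number of edges of the reduction's graph. -/
abbrev numEdges (n d : ℕ) : ℕ := 2 * groupSize n * groupSize n * (2 * groupSize n * (d + 2))

/-- The number of vertices that two points of the reduction's graph dominate if they have no common
neighbor. -/
def goal (n d : ℕ) : ℕ := 2 * (2 * groupSize n * (d + 2) + 1)

/-- The reduction's graph: the points carry the tagged vectors. -/
def reductionIncidence [NeZero n] (A B : Fin n → Fin d → Bool) :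
    PartialDom.Incidence (Fin (2 * groupSize n) × Fin (groupSize n))
      (Fin (2 * groupSize n) × Fin (d + 2)) (Fin (numVertices n d)) :=
  PartialDom.gadgetIncidence fun x => taggedVector A B (vectorOf x)

/-- The list of edges that the reduction writes into the memory. -/
def reductionEdges [NeZero n] (A B : Fin n → Fin d → Bool) :
    List (Fin (numVertices n d) × Fin (numVertices n d)) :=
  (reductionIncidence A B).edgeList PartialDom.flagIndex

theorem isOptimum_reductionIncidence_eq_goal_iff [NeZero n] {t : ℕ}
    (ht : PartialDom.IsOptimum (reductionIncidence A B).graph t) :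
    t = goal n d ↔ HasOrthogonalPair A B := by
  have hsize : 2 * groupSize n < 2 * groupSize n * (d + 2) :=
    lt_mul_of_one_lt_right (Nat.mul_pos two_pos (Nat.succ_pos _)) (Nat.lt_add_left d one_lt_two)
  rw [hasOrthogonalPair_iff_taggedVector, vectorOf_surjective.exists₂
    (p := fun p q => ¬ ∃ y, taggedVector A B p y ∧ taggedVector A B q y)]
  refine PartialDom.isOptimum_gadgetIncidence_eq_iff hsize (fun x x' h => ?_) ht
  exact exists_taggedVector_of_fst_eq (congrArg Fin.divNat h)

theorem numVertices_pos (n d : ℕ) : 0 < numVertices n d := by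
  unfold numVertices groupSize
  positivity

theorem groupSize_mul_le_numEdges (n d : ℕ) :
    18 * (groupSize n * (d + 2)) ≤ numEdges n d ∧
      groupSize n * groupSize n * (12 * (d + 2)) ≤ numEdges n d := by
  have hs : 3 ≤ groupSize n := Nat.le_add_left _ _
  have hm : numEdges n d = 4 * (groupSize n * groupSize n) * (groupSize n * (d + 2)) := by
    unfold numEdges
    ring
  rw [hm]
  constructor
  · have hsq := Nat.mul_le_mul hs hs
    gcongr
    linarith
  · linarith [Nat.mul_le_mul_right (groupSize n * groupSize n * (d + 2)) hs]

theorem numVertices_le_numEdges (n d : ℕ) : numVertices n d ≤ numEdges n d := by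
  have := (groupSize_mul_le_numEdges n d).2
  unfold numVertices
  nlinarith [Nat.zero_le (groupSize n * groupSize n * d)]

theorem numEdges_pos (n d : ℕ) : 0 < numEdges n d :=
  (numVertices_pos n d).trans_le (numVertices_le_numEdges n d)

theorem mul_le_numEdges (n d : ℕ) : n * (d + 2) ≤ numEdges n d :=
  calc n * (d + 2)
    _ ≤ groupSize n * groupSize n * (12 * (d + 2)) :=
      Nat.mul_le_mul (le_groupSize_mul_self n) (Nat.le_mul_of_pos_left _ (by norm_num))
    _ ≤ numEdges n d := (groupSize_mul_le_numEdges n d).2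

theorem four_mul_numEdges_lt_inputSize_pow (hn : 1 ≤ n) :
    4 * numEdges n d < WordRAM.inputSize (encode A B) ^ 6 := by
  obtain ⟨hN, hD⟩ := add_four_le_inputSize_encode (A := A) (B := B)
  generalize WordRAM.inputSize (encode A B) = N at hN hD
  have hs : groupSize n < N := (Nat.add_le_add_right (Nat.sqrt_le_self n) 3).trans_lt (by omega)
  calc 4 * numEdges n d
    _ = 4 * 4 * (groupSize n * groupSize n * groupSize n * (d + 2)) := by unfold numEdges; ring
    _ < N * N * (N * N * N * N) := by gcongr <;> omega
    _ = N ^ 6 := by ring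

end Combinatorics

end OV

/-! ### The reduction as a program -/

namespace OV

open WordRAM

/-- The variables of the reduction: the sizes `n` and `d` of the instance, the size `s` of the
groups, a loop counter `i`, and the number `goal` with which the optimum is compared. -/
inductive Var | n | d | s | i | goal
  deriving DecidableEq

/-- The state in which the variables of the reduction have the given values. -/
def store (n d s goal i : ℕ) (mem : ℕ → ℕ) : Store Var where
  var
    | .n => n
    | .d => d
    | .s => s
    | .goal => goal
    | .i => i
  mem := mem

section Store

variable (n d s goal i k : ℕ) (mem : ℕ → ℕ)

theorem store_set_n : (store n d s goal i mem).set .n k = store k d s goal i mem :=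
  congrArg (Store.mk · mem) (funext fun x => by cases x <;> rfl)

theorem store_set_d : (store n d s goal i mem).set .d k = store n k s goal i mem :=
  congrArg (Store.mk · mem) (funext fun x => by cases x <;> rfl)

theorem store_set_s : (store n d s goal i mem).set .s k = store n d k goal i mem :=
  congrArg (Store.mk · mem) (funext fun x => by cases x <;> rfl)

theorem store_set_goal : (store n d s goal i mem).set .goal k = store n d s k i mem :=
  congrArg (Store.mk · mem) (funext fun x => by cases x <;> rfl)

theorem store_set_i : (store n d s goal i mem).set .i k = store n d s goal k mem :=
  congrArg (Store.mk · mem) (funext fun x => by cases x <;> rfl)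

end Store

section Expressions

def inputWordsExpr : Expr Var := 2 * .var .n * .var .d

def blockExpr : Expr Var := 2 * .var .s * (.var .d + 2)

def numVerticesExpr : Expr Var :=
  2 * .var .s * .var .s + 2 * .var .s * (2 * .var .s) * (.var .d + 2) * 2

def numEdgesExpr : Expr Var := 2 * .var .s * .var .s * blockExpr

def goalExpr : Expr Var := 2 * (blockExpr + 1)

/-- The start of the copy of the input behind the graph's words. -/
def copyExpr : Expr Var := 2 * numEdgesExpr + 2

/-- The point on the edge with number `i / 2`.  Together with the expressions below, it decodes the
word with number `i` in the list of the edges. -/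
def pointExpr : Expr Var := .var .i / 2 / blockExpr

def groupExpr : Expr Var := pointExpr / .var .s

def familyExpr : Expr Var := groupExpr / .var .s

def vectorExpr : Expr Var := pointExpr % (.var .s * .var .s) % .var .n

def otherGroupExpr : Expr Var := .var .i / 2 % blockExpr / (.var .d + 2)

def coordExpr : Expr Var := .var .i / 2 % blockExpr % (.var .d + 2)

def bitExpr : Expr Var :=
  coordExpr.lt (.var .d) *
      .load (copyExpr + ((familyExpr * .var .n + vectorExpr) * .var .d + coordExpr)) +
    (1 - coordExpr.lt (.var .d)) * (coordExpr - .var .d).eq familyExpr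

def linkExpr : Expr Var :=
  let swap := bitExpr * (groupExpr - otherGroupExpr)
  2 * .var .s * .var .s + (bitExpr + 2 * (coordExpr + (.var .d + 2) *
    (otherGroupExpr + swap + 2 * .var .s * (groupExpr - swap))))

def edgeWordExpr : Expr Var := (1 - .var .i % 2) * pointExpr + .var .i % 2 * linkExpr

variable {n d : ℕ} {A B : Fin n → Fin d → Bool}

theorem toNat_taggedVector (p : Fin 2 × Fin n) (y : Fin (d + 2)) :
    (taggedVector A B p y).toNat =
      (if (y : ℕ) < d then 1 else 0) * (initState (encode A B)).mem ((p.1 * n + p.2) * d + y + 2) +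
        (1 - if (y : ℕ) < d then 1 else 0) * if (y : ℕ) - d = p.1 then 1 else 0 := by
  induction y using Fin.addCases with
  | left y =>
    rw [Fin.val_castAdd, if_pos y.isLt, initState_encode_mem_vector]
    simp [taggedVector]
  | right f =>
    by_cases hf : (f : ℕ) = p.1 <;> simp [taggedVector, Fin.ext_iff, hf]

section Eval

variable [NeZero n] {goal k : ℕ} {mem : ℕ → ℕ}

theorem eval_vectorExpr (x : Fin (2 * groupSize n) × Fin (groupSize n))
    (hx : pointExpr.eval (store n d (groupSize n) goal k mem) = x.2 + groupSize n * x.1) :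
    vectorExpr.eval (store n d (groupSize n) goal k mem) = (vectorOf x).2 := by
  rw [vectorExpr, Expr.eval_mod, Expr.eval_mod, hx]
  rfl

theorem eval_bitExpr (x : Fin (2 * groupSize n) × Fin (groupSize n)) (y : Fin (d + 2))
    (hmem : ∀ j < 2 * n * d,
      mem (2 * numEdges n d + 2 + j) = (initState (encode A B)).mem (j + 2))
    (hgroup : groupExpr.eval (store n d (groupSize n) goal k mem) = x.1)
    (hvector : vectorExpr.eval (store n d (groupSize n) goal k mem) = (vectorOf x).2)
    (hcoord : coordExpr.eval (store n d (groupSize n) goal k mem) = y) :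
    bitExpr.eval (store n d (groupSize n) goal k mem) =
      (taggedVector A B (vectorOf x) y).toNat := by
  have hfamily : familyExpr.eval (store n d (groupSize n) goal k mem) = (vectorOf x).1 := by
    rw [familyExpr, Expr.eval_div, hgroup]
    rfl
  have hload : (if (y : ℕ) < d then 1 else 0) * mem (2 * numEdges n d + 2 +
        (((vectorOf x).1 * n + (vectorOf x).2) * d + y)) =
      (if (y : ℕ) < d then 1 else 0) *
        (initState (encode A B)).mem (((vectorOf x).1 * n + (vectorOf x).2) * d + y + 2) := by
    split_ifs with hy
    · have hlt := (finProdFinEquiv (finProdFinEquiv (vectorOf x), (⟨y, hy⟩ : Fin d))).isLt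
      simp only [finProdFinEquiv_apply_val] at hlt
      rw [hmem _ (by linarith)]
    · simp only [zero_mul]
  rw [toNat_taggedVector, ← hload]
  simp only [bitExpr, Expr.eval_add, Expr.eval_mul, Expr.eval_sub, Expr.eval_lt, Expr.eval_eq,
    Expr.eval_load, Expr.eval_ofNat, hfamily, hvector, hcoord]
  rfl

theorem eval_edgeWordExpr (hk : k < 2 * numEdges n d)
    (hmem : ∀ j < 2 * n * d,
      mem (2 * numEdges n d + 2 + j) = (initState (encode A B)).mem (j + 2)) :
    edgeWordExpr.eval (store n d (groupSize n) goal k mem) =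
      (initState (PartialDom.encode (reductionEdges A B))).mem (k + 2) := by
  have hk' : k / 2 < numEdges n d := Nat.div_lt_of_lt_mul hk
  set σ := store n d (groupSize n) goal k mem
  set flag := PartialDom.flagIndex (D := d + 2) ⟨k / 2, hk'⟩ with hflag
  have hpoint : pointExpr.eval σ = (reductionIncidence A B).point flag.1 :=
    (Nat.mod_add_div _ _).symm
  have hgroup : groupExpr.eval σ = flag.1.1 := rfl
  have hother : otherGroupExpr.eval σ = flag.2.1 := rfl
  have hcoord : coordExpr.eval σ = flag.2.2 := rfl
  have hbit := eval_bitExpr _ _ hmem hgroup (eval_vectorExpr _ hpoint) hcoord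
  have hlink : linkExpr.eval σ = (reductionIncidence A B).link flag.1 flag.2 := by
    rw [reductionIncidence, PartialDom.val_gadgetIncidence_link, ← hbit, ← hgroup, ← hother,
      ← hcoord]
    rfl
  rw [reductionEdges, PartialDom.Incidence.edgeList,
    PartialDom.initState_encode_ofFn_mem_add_two _ hk', ← hflag, ← hpoint, ← hlink]
  have hi : (Expr.var Var.i).eval σ = k := rfl
  simp only [edgeWordExpr, Expr.eval_add, Expr.eval_mul, Expr.eval_sub, Expr.eval_mod,
    Expr.eval_ofNat, hi]
  obtain h | h := Nat.mod_two_eq_zero_or_one k <;> simp [h]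

end Eval

end Expressions


section Programs

variable (L : Layout Var)

/-- The indicator of `(i + 1) ^ 2 ≤ n`. -/
def squareLeExpr : Expr Var := .lt ((.var .i + 1) * (.var .i + 1)) (.var .n + 1)

/-- Read the sizes, and compute the size of the groups and the goal. -/
def setup : Cmd :=
  .seq (L.assign .n (.load 0)) <| .seq (L.assign .d (.load 1)) <| .seq (L.assign .s 3) <|
    .seq (L.forLoop .i (.var .n) (L.assign .s (.var .s + squareLeExpr))) <|
      L.assign .goal goalExpr

/-- Copy the vectors behind the cells that the graph will occupy. -/
def copyInput : Cmd := L.fill .i copyExpr inputWordsExpr (.load (.var .i + 2))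

/-- Write the encoding of the graph, reading the vectors from their copy. -/
def writeGraph : Cmd :=
  .seq (L.store 0 numVerticesExpr) <| .seq (L.store 1 numEdgesExpr) <|
    L.fill .i 2 (2 * numEdgesExpr) edgeWordExpr

/-- Erase the copy of the vectors: a subroutine may rely on memory that is `0` after its input. -/
def clearCopy : Cmd := L.fill .i copyExpr inputWordsExpr 0

/-- Replace the instance in the memory by the reduction's graph. -/
def prepare : Cmd :=
  .seq (setup L) <| .seq (copyInput L) <| .seq (writeGraph L) <| clearCopy L

variable {L} {n d s goal i k M : ℕ} {mem : ℕ → ℕ}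

theorem store_overwrite_set_i (a N : ℕ) (v : ℕ → ℕ) :
    ((store n d s goal i mem).overwrite a N v).set .i k =
      store n d s goal k (writeBlock mem a N v) :=
  store_set_i n d s goal i k _

theorem goal_lt (n d : ℕ) : OV.goal n d < 4 * numEdges n d := by
  have hle := (groupSize_mul_le_numEdges n d).1
  have hpos : 0 < groupSize n * (d + 2) := Nat.mul_pos (Nat.succ_pos _) (Nat.succ_pos _)
  unfold OV.goal
  linarith

theorem groupSize_lt (n d : ℕ) : groupSize n < 4 * numEdges n d := by
  have hle := (groupSize_mul_le_numEdges n d).1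
  have hpos : 0 < groupSize n := Nat.succ_pos _
  nlinarith

theorem add_add_one_lt (hn : 1 ≤ n) (d : ℕ) : n + d + 1 < 4 * numEdges n d := by
  nlinarith [mul_le_numEdges n d]

/-- The rounded square root of `n` is the number of the `i < n` with `(i + 1) ^ 2 ≤ n`.  Here and
below, the exponent `1000` bounds the weights of all expressions of the reduction, and the numbers
of steps come from the sizes of the expressions. -/
theorem runs_squareRoot (hn : n < M) (hM : groupSize n < M) :
    L.Runs M 1000 (L.forLoop .i (.var .n) (L.assign .s (.var .s + squareLeExpr)))
      (store n d 3 goal i mem) (store n d (groupSize n) goal n mem) (22 * (n + 1)) := by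
  let R (k : ℕ) : Store Var := store n d (min k n.sqrt + 3) goal i mem
  have hstep : ∀ k < n, L.Runs M 1000 (L.assign .s (.var .s + squareLeExpr))
      ((R k).set .i k) ((R (k + 1)).set .i k) 14 := by
    intro k _
    have hs : min (k + 1) n.sqrt + 3 ≤ groupSize n := Nat.add_le_add_right (min_le_right _ _) 3
    simp only [R, store_set_i]
    have hval : (Expr.var Var.s + squareLeExpr).eval (store n d (min k n.sqrt + 3) goal k mem) =
        min (k + 1) n.sqrt + 3 := by
      change min k n.sqrt + 3 + (if (k + 1) * (k + 1) < n + 1 then 1 else 0) = _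
      simp only [Nat.lt_succ_iff, ← Nat.le_sqrt]
      split_ifs <;> omega
    have hassign := Layout.Runs.assign (L := L) (K := 1000) (x := .s) (by decide) hval
      (hs.trans_lt hM)
    rwa [store_set_s] at hassign
  have hloop := Layout.Runs.forLoop (e := .var .n) (R := R) (by decide) hn (fun _ _ => rfl) hstep
  simp only [R, store_set_i, Nat.zero_min, zero_add, min_eq_right (Nat.sqrt_le_self n)] at hloop
  exact hloop.mono (by rw [mul_comm]; rfl)

theorem runs_setup (hn : 1 ≤ n) (hmem₀ : mem 0 = n) (hmem₁ : mem 1 = d) :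
    L.Runs (4 * numEdges n d) 1000 (setup L) (store 0 0 0 0 0 mem)
      (store n d (groupSize n) (OV.goal n d) n mem) (22 * n + 42) := by
  have hM := add_add_one_lt hn d
  have hset_n := Layout.Runs.assign (L := L) (K := 1000) (x := .n) (e := .load 0)
    (σ := store 0 0 0 0 0 mem) (by decide) hmem₀ (by omega : n < 4 * numEdges n d)
  have hset_d := Layout.Runs.assign (L := L) (K := 1000) (x := .d) (e := .load 1)
    (σ := store n 0 0 0 0 mem) (by decide) hmem₁ (by omega : d < 4 * numEdges n d)
  have hset_s := Layout.Runs.assign (L := L) (K := 1000) (x := .s) (e := 3)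
    (σ := store n d 0 0 0 mem) (by decide) rfl
    ((Nat.le_add_left 3 _).trans_lt (groupSize_lt n d))
  have hset_goal := Layout.Runs.assign (L := L) (K := 1000) (x := .goal) (e := goalExpr)
    (σ := store n d (groupSize n) 0 n mem) (by decide) rfl (goal_lt n d)
  rw [store_set_n] at hset_n
  rw [store_set_d] at hset_d
  rw [store_set_s] at hset_s
  rw [store_set_goal] at hset_goal
  have hroot := runs_squareRoot (L := L) (d := d) (goal := 0) (i := 0) (mem := mem)
    (by omega : n < 4 * numEdges n d) (groupSize_lt n d)
  refine (hset_n.seq <| hset_d.seq <| hset_s.seq <| hroot.seq hset_goal).mono ?_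
  change 3 + (3 + (2 + (22 * (n + 1) + 12))) ≤ _
  omega

theorem mul_le_two_mul_numEdges (n d : ℕ) : 2 * n * d ≤ 2 * numEdges n d := by
  nlinarith [mul_le_numEdges n d]

theorem runs_copyInput (hn : 1 ≤ n) (hmem : ∀ a, mem a < 4 * numEdges n d) :
    L.Runs (4 * numEdges n d) 1000 (copyInput L) (store n d (groupSize n) goal i mem)
      (store n d (groupSize n) goal (2 * n * d)
        (writeBlock mem (2 * numEdges n d + 2) (2 * n * d) fun j => mem (j + 2)))
      ((2 * n * d + 1) * 36) := by
  have hle := mul_le_two_mul_numEdges n d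
  have hM := add_add_one_lt hn d
  rw [← store_overwrite_set_i (i := i)]
  refine Layout.Runs.fill (by decide) (by decide) (by decide) (by omega) ?_ ?_ ?_
    fun k _ => hmem _
  · exact fun k _ => by rw [store_overwrite_set_i]; rfl
  · exact fun k _ => by rw [store_overwrite_set_i]; rfl
  · intro k hk
    rw [store_overwrite_set_i]
    have hout : ¬(2 * numEdges n d + 2 ≤ k + 2 ∧ k + 2 < 2 * numEdges n d + 2 + k) := by omega
    exact if_neg hout

theorem runs_clearCopy (hn : 1 ≤ n) :
    L.Runs (4 * numEdges n d) 1000 (clearCopy L) (store n d (groupSize n) goal i mem)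
      (store n d (groupSize n) goal (2 * n * d)
        (writeBlock mem (2 * numEdges n d + 2) (2 * n * d) fun _ => 0))
      ((2 * n * d + 1) * 33) := by
  have hle := mul_le_two_mul_numEdges n d
  have hM := add_add_one_lt hn d
  rw [← store_overwrite_set_i (i := i)]
  refine Layout.Runs.fill (by decide) (by decide) (by decide) (by omega) ?_ ?_ ?_
    fun k _ => by omega
  · exact fun k _ => by rw [store_overwrite_set_i]; rfl
  · exact fun k _ => by rw [store_overwrite_set_i]; rfl
  · exact fun k _ => by rw [store_overwrite_set_i]; rfl

section Graph

variable [NeZero n] {A B : Fin n → Fin d → Bool}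

theorem length_reductionEdges : (reductionEdges A B).length = numEdges n d :=
  List.length_ofFn

theorem initState_encode_reductionEdges_mem_lt (a : ℕ) :
    (initState (PartialDom.encode (reductionEdges A B))).mem a < 4 * numEdges n d := by
  have hm := numEdges_pos n d
  refine initState_mem_lt (by omega) (fun v hv => ?_) a
  have hle := PartialDom.le_length_of_mem_encode
    ((numVertices_le_numEdges n d).trans_eq length_reductionEdges.symm) hv
  rw [length_reductionEdges] at hle
  omega

theorem runs_writeEdges
    (hmem : ∀ j < 2 * n * d,
      mem (2 * numEdges n d + 2 + j) = (initState (encode A B)).mem (j + 2)) :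
    L.Runs (4 * numEdges n d) 1000 (L.fill .i 2 (2 * numEdgesExpr) edgeWordExpr)
      (store n d (groupSize n) goal i mem)
      (store n d (groupSize n) goal (2 * numEdges n d)
        (writeBlock mem 2 (2 * numEdges n d) fun k =>
          (initState (PartialDom.encode (reductionEdges A B))).mem (k + 2)))
      ((2 * numEdges n d + 1) * 604) := by
  have hm := numEdges_pos n d
  rw [← store_overwrite_set_i (i := i)]
  refine Layout.Runs.fill (by decide) (by decide) (by decide) (by omega) (fun _ _ => rfl) ?_ ?_
    fun k _ => initState_encode_reductionEdges_mem_lt _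
  · exact fun k _ => by rw [store_overwrite_set_i]; rfl
  · intro k hk
    rw [store_overwrite_set_i]
    exact eval_edgeWordExpr hk fun j hj => (if_neg (by omega)).trans (hmem j hj)

theorem runs_writeGraph
    (hmem : ∀ j < 2 * n * d,
      mem (2 * numEdges n d + 2 + j) = (initState (encode A B)).mem (j + 2)) :
    L.Runs (4 * numEdges n d) 1000 (writeGraph L) (store n d (groupSize n) goal i mem)
      (store n d (groupSize n) goal (2 * numEdges n d)
        (writeBlock mem 0 (2 * numEdges n d + 2)
          (initState (PartialDom.encode (reductionEdges A B))).mem))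
      (36 + (2 * numEdges n d + 1) * 604) := by
  set graph := (initState (PartialDom.encode (reductionEdges A B))).mem
  have hgraph_lt : ∀ a, graph a < 4 * numEdges n d := initState_encode_reductionEdges_mem_lt
  have hgraph₁ : numEdges n d = graph 1 := length_reductionEdges.symm
  have hstore₀ := Layout.Runs.store (L := L) (K := 1000) (a := 0) (e := numVerticesExpr)
    (σ := store n d (groupSize n) goal i mem) (A := 0) (by decide) (by decide) rfl rfl
    (hgraph_lt 0)
  have hstore₁ := Layout.Runs.store (L := L) (K := 1000) (a := 1) (e := numEdgesExpr)
    (σ := (store n d (groupSize n) goal i mem).write 0 (graph 0)) (A := 1) (by decide)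
    (by decide) rfl hgraph₁ (hgraph_lt 1)
  have hfill := runs_writeEdges (L := L) (A := A) (B := B) (goal := goal) (i := i)
    (mem := Function.update (Function.update mem 0 (graph 0)) 1 (graph 1)) fun j hj => by
      rw [Function.update_of_ne (by omega), Function.update_of_ne (by omega), hmem j hj]
  rw [writeBlock_update_zero_one] at hfill
  exact (hstore₀.seq (hstore₁.seq hfill)).mono (by rw [← Nat.add_assoc]; exact le_rfl)

theorem writeBlock_graph_eq :
    writeBlock (writeBlock (writeBlock (initState (encode A B)).mem (2 * numEdges n d + 2)
        (2 * n * d) fun j => (initState (encode A B)).mem (j + 2)) 0 (2 * numEdges n d + 2)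
      (initState (PartialDom.encode (reductionEdges A B))).mem)
      (2 * numEdges n d + 2) (2 * n * d) (fun _ => 0) =
    (initState (PartialDom.encode (reductionEdges A B))).mem := by
  have hle := mul_le_two_mul_numEdges n d
  funext c
  obtain hc | hc := lt_or_ge c (2 * numEdges n d + 2)
  · simp only [writeBlock]
    rw [if_neg (by omega), if_pos (by omega), Nat.sub_zero]
  · rw [PartialDom.initState_encode_mem_eq_zero (by rwa [length_reductionEdges])]
    simp only [writeBlock]
    split_ifs
    any_goals omega
    exact initState_encode_mem_eq_zero (by omega)

theorem initState_encode_mem_lt (a : ℕ) :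
    (initState (encode A B)).mem a < 4 * numEdges n d := by
  have hM := add_add_one_lt (NeZero.one_le (n := n)) d
  exact initState_mem_lt (by omega) (fun v hv => (le_of_mem_encode hv).trans_lt hM) a

theorem runs_prepare :
    L.Runs (4 * numEdges n d) 1000 (prepare L) (store 0 0 0 0 0 (initState (encode A B)).mem)
      (store n d (groupSize n) (OV.goal n d) (2 * n * d)
        (initState (PartialDom.encode (reductionEdges A B))).mem) (2199 * numEdges n d) := by
  have hn : 1 ≤ n := NeZero.one_le
  have hwrite := runs_writeGraph (L := L) (goal := OV.goal n d) (i := 2 * n * d) (A := A) (B := B)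
    (mem := writeBlock (initState (encode A B)).mem (2 * numEdges n d + 2) (2 * n * d)
      fun j => (initState (encode A B)).mem (j + 2)) fun j hj => by
        simp only [writeBlock, Nat.add_sub_cancel_left]
        exact if_pos (by omega)
  have hclear := runs_clearCopy (L := L) (d := d) (goal := OV.goal n d) (i := 2 * numEdges n d)
    (mem := writeBlock (writeBlock (initState (encode A B)).mem (2 * numEdges n d + 2)
      (2 * n * d) fun j => (initState (encode A B)).mem (j + 2)) 0 (2 * numEdges n d + 2)
      (initState (PartialDom.encode (reductionEdges A B))).mem) hn
  rw [writeBlock_graph_eq] at hclear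
  have hsetup := runs_setup (L := L) (d := d) (mem := (initState (encode A B)).mem) hn rfl rfl
  have hcopy := runs_copyInput (L := L) (goal := OV.goal n d) (i := n) (d := d) hn
    (initState_encode_mem_lt (A := A) (B := B))
  have hcost : 22 * n + 42 + ((2 * n * d + 1) * 36 + (36 + (2 * numEdges n d + 1) * 604 +
      (2 * n * d + 1) * 33)) ≤ 2199 * numEdges n d := by
    have hm := mul_le_numEdges n d
    generalize numEdges n d = m at hm ⊢
    nlinarith
  exact (hsetup.seq (hcopy.seq (hwrite.seq hclear))).mono hcost

end Graph

/-- The variables follow the registers of `P` and the register `0` of its result. -/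
def layout (P : Cmd) : Layout Var where
  low := P.regBound + 1
  size := 5
  index :=
    { toFun
        | .n => 0
        | .d => 1
        | .s => 2
        | .i => 3
        | .goal => 4
      inj' := fun x y => by cases x <;> cases y <;> simp }

/-- Orthogonal Vectors by means of a program `P` for Partial 2-Dominating Set. -/
def reduction (P : Cmd) : Cmd :=
  .seq (prepare (layout P)) (.seq P (.op .eq 0 0 ((layout P).reg .goal)))

theorem represents_initState [NeZero n] (A B : Fin n → Fin d → Bool) :
    L.Represents (4 * numEdges n d) (store 0 0 0 0 0 (initState (encode A B)).mem)
      (initState (encode A B)) where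
  reg_low _ _ := rfl
  reg_var x := by cases x <;> rfl
  mem_eq := rfl
  bounded :=
    have hM := add_add_one_lt (NeZero.one_le (n := n)) d
    { two_le := by have := NeZero.one_le (n := n); omega
      var_lt := fun x => by cases x <;> exact Nat.zero_lt_of_lt hM
      mem_lt := initState_encode_mem_lt }

theorem exec_reduction [NeZero n] {A B : Fin n → Fin d → Bool} {P : Cmd} {W W' τ : ℕ} {s : State}
    (hexec : Exec W P (initState (PartialDom.encode (reductionEdges A B))) s τ)
    (hW : W ≤ W') (hM : (4 * numEdges n d) ^ 1000 ≤ W') :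
    ∃ s' t, Exec W' (reduction P) (initState (encode A B)) s' t ∧
      s'.reg 0 = (if s.reg 0 = OV.goal n d then 1 else 0) ∧ t ≤ 2200 * numEdges n d + τ := by
  have hrep₀ := represents_initState (L := layout P) A B
  obtain ⟨u, t, hprepare, ht, hrep⟩ := runs_prepare _ hrep₀
  obtain ⟨u', hrun, hagree⟩ :=
    hexec.exists_of_agreeBelow (Nat.le_succ P.regBound) (u := u) ⟨hrep.reg_low, hrep.mem_eq⟩
  have hgoal : u'.reg ((layout P).reg .goal) = OV.goal n d :=
    (hrun.reg_eq_of_regBound_le (Nat.le_add_right _ 5)).trans (hrep.reg_var .goal)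
  have hval : BinOp.eq.eval (u'.reg 0) (u'.reg ((layout P).reg .goal)) =
      if s.reg 0 = OV.goal n d then 1 else 0 := by
    rw [hgoal, hagree.reg 0 (Nat.succ_pos _)]
    rfl
  have htwo : 2 ≤ W' := (hrep₀.bounded.two_le.trans (Nat.le_self_pow (by decide) _)).trans hM
  have hlt : BinOp.eq.eval (u'.reg 0) (u'.reg ((layout P).reg .goal)) < W' := by
    rw [hval]
    split_ifs <;> omega
  refine ⟨_, _, .seq _ _ _ _ _ _ _ (hprepare.mono hM)
    (.seq _ _ _ _ _ _ _ (hrun.mono hW) (.op _ _ _ _ _ hlt)), ?_, ?_⟩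
  · rw [State.reg_setReg_self, hval]
  · linarith only [ht, numEdges_pos n d]

theorem inputSize_encode_reductionEdges_le [NeZero n] (A B : Fin n → Fin d → Bool) :
    inputSize (PartialDom.encode (reductionEdges A B)) ≤ 4 * numEdges n d := by
  have hle := (groupSize_mul_le_numEdges n d).1
  have hpos : 0 < groupSize n * (d + 2) := Nat.mul_pos (Nat.succ_pos _) (Nat.succ_pos _)
  rw [← length_reductionEdges (A := A) (B := B)] at hle ⊢
  exact PartialDom.inputSize_encode_le
    ((numVertices_le_numEdges n d).trans_eq length_reductionEdges.symm) (by omega)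

theorem solves_reduction {P : Cmd} {T : ℕ → ℝ} (hP : PartialDom.Solves P T) {D : ℕ → ℕ}
    {T' : ℕ → ℝ} (hT : ∀ n d, 1 ≤ n → d ≤ D n →
      2200 * (numEdges n d : ℝ) + T (numEdges n d) ≤ T' n) :
    Solves (reduction P) D T' := by
  obtain ⟨c, hP⟩ := hP
  refine ⟨6 * (1000 + c), fun n d A B hn hd => ?_⟩
  have : NeZero n := ⟨by omega⟩
  have : Nonempty (Fin (numVertices n d)) := ⟨⟨0, numVertices_pos n d⟩⟩
  have hedges := (reductionIncidence A B).isEdgeList_edgeList PartialDom.flagIndex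
  have hcard : (reductionIncidence A B).graph.edgeSet.ncard = numEdges n d :=
    hedges.ncard_edgeSet.trans length_reductionEdges
  obtain ⟨t, ht⟩ := PartialDom.exists_isOptimum (reductionIncidence A B).graph
  obtain ⟨s, τ, hexec, hs, hτ⟩ := hP _ _ (reductionEdges A B) t (numVertices_pos n d)
    ((numVertices_le_numEdges n d).trans_eq hcard.symm) hedges ht
  have hpow {a K : ℕ} (ha : a ≤ inputSize (encode A B) ^ 6) (hK : K ≤ 1000 + c) :
      a ^ K ≤ (inputSize (encode A B) ^ 6) ^ (1000 + c) :=
    (Nat.pow_le_pow_left ha K).trans (Nat.pow_le_pow_right (pow_pos (Nat.succ_pos _) 6) hK)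
  have hm := (four_mul_numEdges_lt_inputSize_pow (A := A) (B := B) hn).le
  obtain ⟨s', t', hexec', hs', ht'⟩ := exec_reduction hexec
    (hpow ((inputSize_encode_reductionEdges_le A B).trans hm) (Nat.le_add_left c 1000))
    (hpow hm (Nat.le_add_right 1000 c))
  rw [← pow_mul] at hexec'
  refine ⟨s', t', hexec', ?_, ?_⟩
  · classical
    rw [hs', hs]
    exact if_congr (isOptimum_reductionIncidence_eq_goal_iff ht) rfl rfl
  · rw [hcard] at hτ
    calc (t' : ℝ) ≤ 2200 * numEdges n d + τ := by exact_mod_cast ht'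
      _ ≤ 2200 * numEdges n d + T (numEdges n d) := by gcongr
      _ ≤ T' n := hT n d hn hd

end Programs

end OV

/-! ### The running time -/

namespace OV

/-- Dimensions that grow as the square of the logarithm. -/
noncomputable def logSq (n : ℕ) : ℕ := ⌈Real.log n ^ 2⌉₊

theorem log_isLittleO_logSq :
    (fun n : ℕ => Real.log n) =o[Filter.atTop] fun n : ℕ => (logSq n : ℝ) := by
  have hlog : Filter.Tendsto (fun n : ℕ => Real.log n) Filter.atTop Filter.atTop :=
    Real.tendsto_log_atTop.comp tendsto_natCast_atTop_atTop
  have hsq : (fun n : ℕ => Real.log n ^ 1) =o[Filter.atTop] fun n : ℕ => Real.log n ^ 2 :=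
    (Asymptotics.isLittleO_pow_pow_atTop_of_lt one_lt_two).comp_tendsto hlog
  simp only [pow_one] at hsq
  refine hsq.trans_le fun n => ?_
  rw [Real.norm_of_nonneg (sq_nonneg _), Real.norm_of_nonneg (Nat.cast_nonneg _)]
  exact Nat.le_ceil _

theorem logSq_add_two_le {δ : ℝ} (hδ : 0 < δ) {n : ℕ} (hn : 1 ≤ n) :
    (logSq n : ℝ) + 2 ≤ (4 / δ ^ 2 + 3) * (n : ℝ) ^ δ := by
  have hn' : (1 : ℝ) ≤ n := by exact_mod_cast hn
  have hceil : (logSq n : ℝ) ≤ Real.log n ^ 2 + 1 := (Nat.ceil_lt_add_one (sq_nonneg _)).le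
  have hone : (1 : ℝ) ≤ (n : ℝ) ^ δ := Real.one_le_rpow hn' hδ.le
  have hlog : Real.log n ^ 2 ≤ 4 / δ ^ 2 * (n : ℝ) ^ δ :=
    calc Real.log n ^ 2
      _ ≤ ((n : ℝ) ^ (δ / 2) / (δ / 2)) ^ 2 :=
        pow_le_pow_left₀ (Real.log_nonneg hn')
          (Real.log_le_rpow_div (Nat.cast_nonneg n) (half_pos hδ)) 2
      _ = 4 / δ ^ 2 * ((n : ℝ) ^ (δ / 2)) ^ 2 := by ring
      _ = 4 / δ ^ 2 * (n : ℝ) ^ δ := by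
        rw [← Real.rpow_mul_natCast (Nat.cast_nonneg n), Nat.cast_ofNat,
          div_mul_cancel₀ _ two_ne_zero]
  linarith

theorem numEdges_le {n : ℕ} (hn : 1 ≤ n) (d : ℕ) :
    (numEdges n d : ℝ) ≤ 256 * (n : ℝ) ^ (3 / 2 : ℝ) * (d + 2) := by
  have hn' : (1 : ℝ) ≤ √n := Real.one_le_sqrt.2 (by exact_mod_cast hn)
  have hs : (groupSize n : ℝ) ≤ 4 * √n := by
    have hsqrt := Real.nat_sqrt_le_real_sqrt (a := n)
    rw [groupSize, Nat.cast_add, Nat.cast_ofNat]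
    linarith
  have hpow : (n : ℝ) ^ (3 / 2 : ℝ) = √n ^ 3 := by
    rw [Real.sqrt_eq_rpow, ← Real.rpow_mul_natCast (Nat.cast_nonneg n)]
    norm_num
  calc (numEdges n d : ℝ)
    _ = 4 * (groupSize n : ℝ) ^ 3 * (d + 2) := by push_cast; ring
    _ ≤ 4 * (4 * √n) ^ 3 * (d + 2) := by gcongr
    _ = 256 * (n : ℝ) ^ (3 / 2 : ℝ) * (d + 2) := by rw [hpow]; ring

theorem numEdges_le_of_le_logSq {δ : ℝ} (hδ : 0 < δ) {n d : ℕ} (hn : 1 ≤ n) (hd : d ≤ logSq n) :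
    (numEdges n d : ℝ) ≤ 256 * (4 / δ ^ 2 + 3) * (n : ℝ) ^ (3 / 2 + δ) := by
  have hd' : (d : ℝ) ≤ logSq n := by exact_mod_cast hd
  calc (numEdges n d : ℝ)
    _ ≤ 256 * (n : ℝ) ^ (3 / 2 : ℝ) * (d + 2) := numEdges_le hn d
    _ ≤ 256 * (n : ℝ) ^ (3 / 2 : ℝ) * ((4 / δ ^ 2 + 3) * (n : ℝ) ^ δ) := by
      gcongr
      linarith [logSq_add_two_le hδ hn]
    _ = 256 * (4 / δ ^ 2 + 3) * (n : ℝ) ^ (3 / 2 + δ) := by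
      rw [Real.rpow_add (by exact_mod_cast hn)]
      ring

/-- Decreasing `ε` to `η ≤ 1 / 3` makes the exponent at least `1`, so that the time for the
reduction is absorbed.  The rest is `(3 / 2 + η / 4) * (4 / 3 - η) ≤ 2 - η`. -/
theorem exists_time_le (C₀ C : ℝ) {ε : ℝ} (hε : 0 < ε) :
    ∃ η C' : ℝ, 0 < η ∧ ∀ n d : ℕ, 1 ≤ n → d ≤ logSq n →
      C₀ * (numEdges n d : ℝ) + C * (numEdges n d : ℝ) ^ (4 / 3 - ε) ≤
        C' * (n : ℝ) ^ (2 - η) := by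
  obtain ⟨η, hη, hη_le, hηε⟩ : ∃ η, 0 < η ∧ η ≤ 1 / 3 ∧ η ≤ ε :=
    ⟨min ε (1 / 3), by positivity, min_le_right _ _, min_le_left _ _⟩
  set K : ℝ := 256 * (4 / (η / 4) ^ 2 + 3)
  have hK : 0 ≤ K := by positivity
  refine ⟨η, (|C₀| + |C|) * K ^ (4 / 3 - η), hη, fun n d hn hd => ?_⟩
  have hn' : (1 : ℝ) ≤ n := by exact_mod_cast hn
  have hm : (1 : ℝ) ≤ numEdges n d := by exact_mod_cast numEdges_pos n d
  have hm_le : (numEdges n d : ℝ) ≤ K * (n : ℝ) ^ (3 / 2 + η / 4) :=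
    numEdges_le_of_le_logSq (by positivity) hn hd
  generalize (numEdges n d : ℝ) = m at hm hm_le
  calc C₀ * m + C * m ^ (4 / 3 - ε)
    _ ≤ |C₀| * m ^ (4 / 3 - η) + |C| * m ^ (4 / 3 - η) := by
      gcongr
      · exact le_abs_self C₀
      · exact Real.self_le_rpow_of_one_le hm (by linarith)
      · exact le_abs_self C
    _ = (|C₀| + |C|) * m ^ (4 / 3 - η) := by ring
    _ ≤ (|C₀| + |C|) * (K * (n : ℝ) ^ (3 / 2 + η / 4)) ^ (4 / 3 - η) := by
      gcongr
      linarith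
    _ = (|C₀| + |C|) * K ^ (4 / 3 - η) * (n : ℝ) ^ ((3 / 2 + η / 4) * (4 / 3 - η)) := by
      rw [Real.mul_rpow hK (by positivity), ← Real.rpow_mul (by linarith), mul_assoc]
    _ ≤ (|C₀| + |C|) * K ^ (4 / 3 - η) * (n : ℝ) ^ (2 - η) := by
      gcongr
      nlinarith

end OV

theorem mainTheorem8 (ε : ℝ) (hε : 0 < ε)
    (h : ∃ (P : WordRAM.Cmd) (C : ℝ),
      PartialDom.Solves P fun m => C * (m : ℝ) ^ (4 / 3 - ε)) :
    ¬ OV.Hypothesis := by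
  obtain ⟨P, C, hP⟩ := h
  obtain ⟨η, C', hη, htime⟩ := OV.exists_time_le 2200 C hε
  exact fun hOV => hOV ⟨η, OV.logSq, hη, OV.log_isLittleO_logSq, OV.reduction P, C',
    OV.solves_reduction hP htime⟩
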